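/- Let $X=\mathbb{R}^p$ and $U=\mathbb{R}^q$. For $n\ge 0$ let $X\times U^{(n)}$ be the jet space with coordinates $x^i$ ($1\le i\le p$) and $u^\alpha_J$ ($1\le\alpha\le q$), where $J$ runs over the unordered multi-indices with entries in $\{1,\dots,p\}$ of order at most $n$ (and $u^\alpha_\emptyset=u^\alpha$). The $n$-jet of a smooth $f:X\to U$ at $x$ is the point $(x,\mathrm{pr}^{(n)}f(x))$ with coordinates $u^\alpha_J=\partial_Jf^\alpha(x)$. Let a finite-dimensional Lie group $G$ with Lie algebra $\mathfrak g$ act smoothly (globally, or only locally, i.e. on an open neighbourhood of $\{e\}\times(X\times U)$ in $G\times(X\times U)$) on $X\times U$. Given $z=(x_0,u_0^{(n)})$ and $g\in G$, choose a smooth $f$ with $n$-jet $z$ at $x_0$, put $(\tilde x_0,\tilde u_0)=g\cdot(x_0,u_0)$, and let $\tilde f$ be a function, smooth near $\tilde x_0$, whose graph coincides with $g\cdot\Gamma_f$ near $(\tilde x_0,\tilde u_0)$, where $\Gamma_f$ is the graph of $f$; then $\mathrm{pr}^{(n)}g\cdot z$ is the $n$-jet of $\tilde f$ at $\tilde x_0$.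 For $\mathbf v\in\mathfrak g$, the infinitesimal action of $\mathbf v$ (again denoted $\mathbf v$) is the vector field $y\mapsto\frac{d}{d\epsilon}\big|_{\epsilon=0}\exp(\epsilon\mathbf v)\cdot y$ on $X\times U$, and $\mathrm{pr}^{(n)}\mathbf v$ is the vector field $z\mapsto\frac{d}{d\epsilon}\big|_{\epsilon=0}\mathrm{pr}^{(n)}[\exp(\epsilon\mathbf v)]\cdot z$ on $X\times U^{(n)}$. For a smooth function $P$ on $X\times U^{(m)}$ the total derivative is $D_iP=\frac{\partial P}{\partial x^i}+\sum_{\alpha}\sum_{J}u^\alpha_{J,i}\frac{\partial P}{\partial u^\alpha_J}$, where $u^\alpha_{J,i}$ denotes the coordinate whose multi-index is $J$ with $i$ adjoined, and $D_J=D_{j_1}\cdots D_{j_k}$ for $J=(j_1,\dots,j_k)$. **Theorem.** Let $\Theta:X\times U\to\mathbb{R}^r$ be a smooth function library and $W\in\mathbb{R}^{(p+q)\times r}$ a matrix with rows $W_1^\top,\dots,W_{p+q}^\top$. Suppose that the infinitesimal action of $\mathbf v\in\mathfrak g$ is $$\mathbf v=W\Theta(x,u)\cdot\nabla=\sum_{i=1}^p\Theta^\top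 W_i\frac{\partial}{\partial x^i}+\sum_{\alpha=1}^q\Theta^\top W_{p+\alpha}\frac{\partial}{\partial u^\alpha}.$$ Then at every point of $X\times U^{(n)}$ the prolonged action $\mathrm{pr}^{(n)}[\exp(\epsilon\mathbf v)]$ is well defined for all sufficiently small $\epsilon$ and differentiable in $\epsilon$ at $\epsilon=0$, and $$\mathrm{pr}^{(n)}\mathbf v=\mathbf v+\sum_{\alpha=1}^q\sum_J\phi^J_\alpha(x,u^{(n)})\frac{\partial}{\partial u^\alpha_J},$$ where $J=(j_1,\dots,j_k)$ runs over the multi-indices of order $1\le k\le n$ and $$\phi^J_\alpha=-\sum_{i=1}^p\sum_{I\subsetneq J}u^\alpha_{I,i}\,D_{J\setminus I}\Theta^\top W_i+D_J\Theta^\top W_{p+\alpha};$$ here $I$ runs over the sub-tuples of $J$ given by the proper subsets of the set of positions $\{1,\dots,k\}$ (so that repeated entries are counted with multiplicity), including the empty one, and $J\setminus I$ is the complementary sub-tuple. In particular $\mathrm{pr}^{(n)}\mathbf v$ is linear in $W$: there is a matrix-valued function $\Theta_n$ on $X\times U^{(n)}$, depending only on $p,q,r,n$ and $\Theta$, such that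 $\mathrm{pr}^{(n)}\mathbf v=\Theta_n(x,u^{(n)})\,\mathrm{vec}(W)\cdot\nabla$, where $\mathrm{vec}(W)$ lists the rows $W_1,\dots,W_{p+q}$ one after another. -/

import Mathlib

open scoped Manifold ContDiff Topology Matrix

noncomputable section

namespace Prolongation

/-! ### The exponential map of a Lie group -/

section Exponential

variable {E : Type*} [NormedAddCommGroup E] [NormedSpace ℝ E] [FiniteDimensional ℝ E]
  {G : Type*} [TopologicalSpace G] [ChartedSpace E G] [Group G] [LieGroup 𝓘(ℝ, E) ∞ G]
  [T2Space G]

/-- Left-invariant vector fields on a Lie group are complete. -/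
theorem exists_integralCurve (v : GroupLieAlgebra 𝓘(ℝ, E) G) :
    ∃ γ : ℝ → G, γ 0 = 1 ∧ IsMIntegralCurve (I := 𝓘(ℝ, E)) γ (mulInvariantVectorField v) := by
  have h3 : LieGroup 𝓘(ℝ, E) (minSmoothness ℝ 3) G := by
    rw [minSmoothness_of_isRCLikeNormedField]
    exact LieGroup.of_le (n := ∞) (WithTop.coe_le_coe.2 (le_top : (3 : ℕ∞) ≤ ⊤))
  have : IsManifold 𝓘(ℝ, E) 1 G := IsManifold.of_le (n := ∞) (by exact_mod_cast (le_top : (1 : ℕ∞) ≤ ⊤))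
  have : CompleteSpace E := FiniteDimensional.complete ℝ E
  have hv : ContMDiff 𝓘(ℝ, E) 𝓘(ℝ, E).tangent 1
      (fun g : G => (mulInvariantVectorField v g : TangentBundle 𝓘(ℝ, E) G)) := by
    refine (contMDiff_mulInvariantVectorField v).of_le ?_
    rw [minSmoothness_of_isRCLikeNormedField]
    exact one_le_two
  obtain ⟨γ, h0, hγ⟩ := exists_isMIntegralCurveAt_of_contMDiffAt_boundaryless
    (t₀ := (0 : ℝ)) (x₀ := (1 : G)) hv.contMDiffAt
  obtain ⟨ε, hε, hγ⟩ := isMIntegralCurveAt_iff'.mp hγ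
  rw [Real.ball_eq_Ioo, zero_sub, zero_add] at hγ
  refine exists_isMIntegralCurve_of_isMIntegralCurveOn hv hε (fun x => ?_) 1
  refine ⟨fun t => x * γ t, by simp [h0], fun t ht => ?_⟩
  have hmul : ∀ y z : G, MDifferentiableAt 𝓘(ℝ, E) 𝓘(ℝ, E) (fun b : G => y * b) z :=
    fun y z => (contMDiff_mul_left (I := 𝓘(ℝ, E)) (n := ∞) (a := y)).mdifferentiableAt (by simp)
  have h1 := (hmul x (γ t)).hasMFDerivAt.comp_hasMFDerivWithinAt t (hγ t ht)
  have h2 : mulInvariantVectorField (I := 𝓘(ℝ, E)) v (x * γ t) =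
      mfderiv 𝓘(ℝ, E) 𝓘(ℝ, E) (fun b : G => x * b) (γ t) (mulInvariantVectorField v (γ t)) := by
    let A : G → E →L[ℝ] E := fun z => mfderiv 𝓘(ℝ, E) 𝓘(ℝ, E) (fun b : G => x * b) z
    let B : E →L[ℝ] E := mfderiv 𝓘(ℝ, E) 𝓘(ℝ, E) (fun b : G => γ t * b) 1
    have h4 : (mfderiv 𝓘(ℝ, E) 𝓘(ℝ, E) ((fun b : G => x * b) ∘ (fun b : G => γ t * b)) 1 :
        E →L[ℝ] E) = (A (γ t * 1)).comp B :=
      mfderiv_comp_of_eq (hmul x (γ t)) (hmul (γ t) 1) (mul_one _)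
    rw [mul_one] at h4
    have h5 : (fun b : G => x * b) ∘ (fun b : G => γ t * b) = fun b : G => x * γ t * b := by
      funext b
      simp [mul_assoc]
    rw [h5] at h4
    exact congrArg (fun L : E →L[ℝ] E => L v) h4
  have h6 : (mfderiv 𝓘(ℝ, E) 𝓘(ℝ, E) (fun b : G => x * b) (γ t)).comp
      ((1 : ℝ →L[ℝ] ℝ).smulRight (mulInvariantVectorField v (γ t))) =
      (1 : ℝ →L[ℝ] ℝ).smulRight (mulInvariantVectorField (I := 𝓘(ℝ, E)) v (x * γ t)) := by
    rw [h2]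
    ext
    simp
  exact h6 ▸ h1

/-- The exponential map `𝔤 → G`: the value at time `1` of the integral curve through the identity
of the left-invariant vector field determined by `v`. -/
def lieExp (v : GroupLieAlgebra 𝓘(ℝ, E) G) : G :=
  Classical.choose (exists_integralCurve v) 1

end Exponential

/-! ### Jet spaces -/

/-- Unordered multi-indices `J = {j₁, …, j_k}` with entries in `{1, …, p}` and order `k ≤ n`;
there are `(p + n).choose n` of them. -/
abbrev MultiIndex (p n : ℕ) : Type := {J : Multiset (Fin p) // Multiset.card J ≤ n}

instance (p n : ℕ) : Fintype (MultiIndex p n) :=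
  haveI : Finite (MultiIndex p n) :=
    Finite.of_injective
      (fun J : MultiIndex p n =>
        (⟨⟨Multiset.card J.1, Nat.lt_succ_of_le J.2⟩, ⟨J.1, rfl⟩⟩ :
          Σ k : Fin (n + 1), Sym (Fin p) k))
      (fun _ _ h => Subtype.ext <|
        congrArg (fun s : Σ k : Fin (n + 1), Sym (Fin p) k => (s.2 : Multiset (Fin p))) h)
  Fintype.ofFinite _

/-- The space `X × U = ℝ^p × ℝ^q` of independent and dependent variables. -/
abbrev Total (p q : ℕ) : Type := (Fin p → ℝ) × (Fin q → ℝ)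

/-- The jet space `X × U^(n)`, with coordinates `x^i` and `u_J^α`, where `J` runs over the
unordered multi-indices of order at most `n`. -/
abbrev Jet (p q n : ℕ) : Type := (Fin p → ℝ) × (MultiIndex p n → Fin q → ℝ)

/-- The index set of the coordinates `x^i`, `u_J^α` on `X × U^(n)`. -/
abbrev JetCoord (p q n : ℕ) : Type := Fin p ⊕ (MultiIndex p n × Fin q)

/-- The column vector of all coordinates of a point of (or a tangent vector to) `X × U^(n)`. -/
def Jet.coords {p q n : ℕ} (z : Jet p q n) : JetCoord p q n → ℝ :=
  Sum.elim z.1 (fun c => z.2 c.1 c.2)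

/-- The coordinate `u_J^α` of `z`; the value is `0` when the order of `J` exceeds `n`. -/
def Jet.u {p q n : ℕ} (z : Jet p q n) (J : Multiset (Fin p)) (α : Fin q) : ℝ :=
  if h : Multiset.card J ≤ n then z.2 ⟨J, h⟩ α else 0

/-- The projection `X × U^(n) → X × U^(m)` for `m ≤ n`. -/
def Jet.proj {p q n : ℕ} (m : ℕ) (z : Jet p q n) : Jet p q m :=
  (z.1, fun J α => z.u J.1 α)

/-- The projection `X × U^(n) → X × U`. -/
def Jet.base {p q n : ℕ} (z : Jet p q n) : Total p q :=
  (z.1, fun α => z.2 ⟨0, Nat.zero_le n⟩ α)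

/-- The iterated partial derivative `∂_{j₁} ⋯ ∂_{j_k} f`. -/
def partialDeriv {p : ℕ} : List (Fin p) → ((Fin p → ℝ) → ℝ) → (Fin p → ℝ) → ℝ
  | [], f => f
  | j :: l, f => fun x => fderiv ℝ (partialDeriv l f) x (Pi.single j 1)

/-- The `n`-jet `(x, pr^(n) f (x))` of `f : X → U` at `x`: `u_J^α = ∂_J f^α (x)`. -/
def jet {p q : ℕ} (n : ℕ) (f : (Fin p → ℝ) → Fin q → ℝ) (x : Fin p → ℝ) : Jet p q n :=
  (x, fun J α => partialDeriv (J.1.sort (· ≤ ·)) (fun y => f y α) x)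

/-! ### Total derivatives -/

/-- The total derivative
`D_i P = ∂P/∂x^i + ∑_α ∑_J u_{J,i}^α ∂P/∂u_J^α` of a function `P` on `X × U^(m)`. -/
def totalDeriv {p q m : ℕ} (i : Fin p) (P : Jet p q m → ℝ) : Jet p q (m + 1) → ℝ := fun z =>
  fderiv ℝ P (z.proj m) (Pi.single i 1, 0) +
    ∑ α : Fin q, ∑ J : MultiIndex p m,
      z.u (i ::ₘ J.1) α * fderiv ℝ P (z.proj m) (0, Pi.single J (Pi.single α 1))

/-- The iterated total derivative `D_J P = D_{j₁} ⋯ D_{j_k} P`. -/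
def totalDerivList {p q m : ℕ} (P : Jet p q m → ℝ) :
    (J : List (Fin p)) → Jet p q (m + J.length) → ℝ
  | [] => P
  | j :: l => totalDeriv j (totalDerivList P l)

/-- The vector `D_J Θ` for a vector `Θ` of functions on `X × U`, as a function on `X × U^(n)`
(for `n` at least the order of `J`). -/
def totalDerivLibrary {p q r n : ℕ} (Θ : Total p q → Fin r → ℝ) (J : List (Fin p))
    (z : Jet p q n) : Fin r → ℝ := fun a =>
  totalDerivList (m := 0) (fun w => Θ w.base a) J (z.proj (0 + J.length))

/-- The tuple `(j_s)_{s ∈ S}` of the entries of `J = (j₁, …, j_k)` at the positions in `S`. -/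
def subtuple {p k : ℕ} (J : Fin k → Fin p) (S : Finset (Fin k)) : List (Fin p) :=
  (S.sort (· ≤ ·)).map J

/-! ### The library vector field and the coefficients of its prolongation -/

/-- The components of `v = W Θ(x, u) · ∇`: the coefficient of `∂/∂x^i` is `Θᵀ W_i` and that of
`∂/∂u^α` is `Θᵀ W_{p+α}`, where `W_j` is the `j`-th row of `W`. -/
def libraryField {p q r : ℕ} (W : Matrix (Fin (p + q)) (Fin r) ℝ) (Θ : Total p q → Fin r → ℝ)
    (y : Total p q) : Total p q :=
  (fun i => Θ y ⬝ᵥ W (Fin.castAdd q i), fun α => Θ y ⬝ᵥ W (Fin.natAdd p α))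

/-- The coefficient
`φ_α^J = - ∑_i ∑_{I ⊂ J} u_{I,i}^α D_{J∖I}Θᵀ W_i + D_JΘᵀ W_{p+α}` for `J = (j₁, …, j_k)`. The inner
sum runs over the proper subsets `S` of the set of positions `{1, …, k}`, so that sub-multi-indices
of `J` are counted with multiplicity. -/
def prolongationCoeff {p q r n k : ℕ} (W : Matrix (Fin (p + q)) (Fin r) ℝ)
    (Θ : Total p q → Fin r → ℝ) (J : Fin k → Fin p) (α : Fin q) (z : Jet p q n) : ℝ :=
  -(∑ i : Fin p, ∑ S ∈ (Finset.univ : Finset (Fin k)).ssubsets,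
      z.u (i ::ₘ (subtuple J S : Multiset (Fin p))) α *
        (totalDerivLibrary Θ (subtuple J Sᶜ) z ⬝ᵥ W (Fin.castAdd q i))) +
    totalDerivLibrary Θ (subtuple J Finset.univ) z ⬝ᵥ W (Fin.natAdd p α)

/-! ### Actions of Lie groups and their prolongations -/

/-- A smooth (possibly only local) action of a Lie group `G` on a vector space `M`: the map
`(g, y) ↦ g · y` is defined and smooth on an open neighbourhood `domain` of `{1} × M` in `G × M`.
Global actions are those with `domain = Set.univ`. -/
structure LieGroupAction (E G M : Type*) [NormedAddCommGroup E] [NormedSpace ℝ E]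
    [TopologicalSpace G] [ChartedSpace E G] [Group G]
    [NormedAddCommGroup M] [NormedSpace ℝ M] where
  /-- The set of pairs `(g, y)` for which `g · y` is defined. -/
  domain : Set (G × M)
  /-- The map `(g, y) ↦ g · y`; its values outside of `domain` are irrelevant. -/
  act : G → M → M
  isOpen_domain : IsOpen domain
  one_mem : ∀ y, ((1 : G), y) ∈ domain
  smooth : ContMDiffOn (𝓘(ℝ, E).prod 𝓘(ℝ, M)) 𝓘(ℝ, M) ∞ (fun z : G × M => act z.1 z.2) domain
  one_act : ∀ y, act 1 y = y
  mul_act : ∀ g h y, (h, y) ∈ domain → (g, act h y) ∈ domain → (g * h, y) ∈ domain →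
    act g (act h y) = act (g * h) y
  inv_mem : ∀ g y, (g, y) ∈ domain → (g⁻¹, act g y) ∈ domain
  inv_act : ∀ g y, (g, y) ∈ domain → act g⁻¹ (act g y) = y

namespace LieGroupAction

section

variable {E G M : Type*} [NormedAddCommGroup E] [NormedSpace ℝ E] [FiniteDimensional ℝ E]
  [TopologicalSpace G] [ChartedSpace E G] [Group G] [NormedAddCommGroup M] [NormedSpace ℝ M]

/-- The image `g · Γ` of a subset `Γ` of `M` (of the part of it where `g` acts). -/
def image (A : LieGroupAction E G M) (g : G) (Γ : Set M) : Set M :=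
  {y | ∃ w ∈ Γ, (g, w) ∈ A.domain ∧ A.act g w = y}

/-- The infinitesimal action of `v ∈ 𝔤`: the vector `d/dε|_{ε=0} exp(εv) · y` at `y`. -/
def infinitesimal [LieGroup 𝓘(ℝ, E) ∞ G] [T2Space G] (A : LieGroupAction E G M)
    (v : GroupLieAlgebra 𝓘(ℝ, E) G) (y : M) : M :=
  deriv (fun ε : ℝ => A.act (lieExp (ε • v)) y) 0

end

variable {E G : Type*} [NormedAddCommGroup E] [NormedSpace ℝ E] [FiniteDimensional ℝ E]
  [TopologicalSpace G] [ChartedSpace E G] [Group G] {p q : ℕ}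

/-- `z'` is the image of the jet `z = (x₀, u₀^(n))` under the `n`-th prolongation of `g`: there are
a smooth function `f` with `n`-jet `z` at `x₀` and a transform `f'` of `f` by `g`, smooth near `x̃₀`,
where `(x̃₀, ũ₀) = g · (x₀, u₀)`, such that `z'` is the `n`-jet of `f'` at `x̃₀`. That `f'` is the
transform of `f` means that the graph of `f'` agrees with `g · Γ_f` near `(x̃₀, ũ₀)`. -/
def IsProlongation (A : LieGroupAction E G (Total p q)) (n : ℕ) (g : G) (z z' : Jet p q n) :
    Prop :=
  (g, z.base) ∈ A.domain ∧
  ∃ f f' : (Fin p → ℝ) → Fin q → ℝ,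
    ContDiff ℝ ∞ f ∧ jet n f z.1 = z ∧
    (∀ᶠ x in 𝓝 (A.act g z.base).1, ContDiffAt ℝ ∞ f' x) ∧
    (∀ᶠ y in 𝓝 (A.act g z.base), y ∈ A.image g {w | w.2 = f w.1} ↔ y.2 = f' y.1) ∧
    z' = jet n f' (A.act g z.base).1

/-- The `n`-th prolongation `pr^(n) g · z` (an arbitrary value where it is not defined). -/
def prolong (A : LieGroupAction E G (Total p q)) (n : ℕ) (g : G) (z : Jet p q n) : Jet p q n :=
  Classical.epsilon (A.IsProlongation n g z)

/-- The `n`-th prolongation `pr^(n) v` of `v ∈ 𝔤`: the vector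
`d/dε|_{ε=0} pr^(n)[exp(εv)] · z` at `z`. -/
def prolongInfinitesimal [LieGroup 𝓘(ℝ, E) ∞ G] [T2Space G]
    (A : LieGroupAction E G (Total p q)) (n : ℕ)
    (v : GroupLieAlgebra 𝓘(ℝ, E) G) (z : Jet p q n) : Jet p q n :=
  deriv (fun ε : ℝ => A.prolong n (lieExp (ε • v)) z) 0

end LieGroupAction

end Prolongation

end

noncomputable section

namespace Prolongation

/-! ### Iterated partial derivatives -/

section PartialDeriv

variable {p : ℕ}

/-! Choose a smooth `f` with n-jet `z` (a polynomial, `exists_jet_eq`) and read the group in a chart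
`a ∈ E` at the identity, `a₀` being the image of `1`. Let `φ(a, x)` and `ψ(a, x)` be the `X`- and
`U`-components of `a · (x, f x)`, so that `φ(a₀, x) = x` and `ψ(a₀, x) = f x`. For `a` near `a₀` the
map `φ_a` is a local diffeomorphism, and `ψ_a ∘ φ_a⁻¹` is the transform of `f` (`exists_transform`).
By the chain rule its derivatives at `φ_a x` are functions `U_J(a, x)`, built recursively from `φ`,
`ψ` and `(∂φ/∂x)⁻¹`, and smooth in `(a, x)` near `a₀` (`transDeriv`, `partialDeriv_transform`). So
the prolonged action exists near `a₀` and can be differentiated in `a`.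

That it is well defined is a jet statement: Faà di Bruno's formula shows that the n-jet of the
transform depends only on the n-jet of `f` (`jet_unique`).

The derivative of `U_J` in the direction of `v` is, by induction on `J`, equal to `∂_J Q + ∑ᵢ ∂_J
∂_i f ξⁱ`, where `(ξ, η)` is `v` along the graph of `f` and `Q = η - ∑ᵢ ∂_i f ξⁱ` is the
characteristic (`fderiv_transDeriv_fst`). Expanding `∂_J Q` by the Leibniz rule over sets of
positions, the terms with all derivatives on `∂_i f` cancel the second sum, and the proper subsets
remain. Since total derivatives evaluated on jets of `f` are ordinary derivatives
(`totalDeriv_jet`), this is the stated formula (`prolongationCoeff_jet`), which is visibly linear in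
`W`. -/

theorem contDiffAt_partialDeriv {f : (Fin p → ℝ) → ℝ} {x : Fin p → ℝ} (hf : ContDiffAt ℝ ∞ f x)
    (l : List (Fin p)) : ContDiffAt ℝ ∞ (partialDeriv l f) x := by
  induction l with
  | nil => exact hf
  | cons j l ih => exact (ih.fderiv_right (m := ∞) le_rfl).clm_apply contDiffAt_const

theorem contDiff_partialDeriv {f : (Fin p → ℝ) → ℝ} (hf : ContDiff ℝ ∞ f) (l : List (Fin p)) :
    ContDiff ℝ ∞ (partialDeriv l f) :=
  contDiff_iff_contDiffAt.2 fun _ => contDiffAt_partialDeriv hf.contDiffAt l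

theorem partialDeriv_eq_iteratedFDeriv {f : (Fin p → ℝ) → ℝ} (l : List (Fin p)) {x : Fin p → ℝ}
    (hf : ContDiffAt ℝ l.length f x) :
    partialDeriv l f x =
      iteratedFDeriv ℝ l.length f x (fun s => Pi.single (l.get s) (1 : ℝ)) := by
  induction l generalizing x with
  | nil => simp [partialDeriv]
  | cons j l ih =>
    have hf' : ContDiffAt ℝ ((l.length : ℕ∞ω) + 1) f x := by exact_mod_cast hf
    have h1 : partialDeriv l f =ᶠ[𝓝 x] fun y =>
        iteratedFDeriv ℝ l.length f y (fun s => Pi.single (l.get s) (1 : ℝ)) := by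
      filter_upwards [(hf'.of_le le_self_add).eventually (by simp)] with y hy using ih hy
    have h2 : DifferentiableAt ℝ (iteratedFDeriv ℝ l.length f) x :=
      (hf'.iteratedFDeriv_right (m := 1) (i := l.length) (by rw [add_comm])).differentiableAt
        (by simp)
    simp only [partialDeriv]
    rw [h1.fderiv_eq]
    change _ = iteratedFDeriv ℝ (l.length + 1) f x _
    rw [iteratedFDeriv_succ_apply_left]
    have := (h2.hasFDerivAt.continuousMultilinear_apply_const
      (fun s => Pi.single (l.get s) (1 : ℝ))).fderiv
    rw [this]
    rfl

/-- Permutations are generated by swaps of adjacent entries, and a swap is the symmetry of the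
second derivative. This makes the sorting in `jet` immaterial. -/
theorem partialDeriv_perm {f : (Fin p → ℝ) → ℝ} (hf : ContDiff ℝ ∞ f) {l l' : List (Fin p)}
    (h : l.Perm l') : partialDeriv l f = partialDeriv l' f := by
  induction h with
  | nil => rfl
  | cons j _ ih => simp only [partialDeriv, ih]
  | swap i j l =>
    funext x
    have hl := contDiff_partialDeriv hf l
    have hd : DifferentiableAt ℝ (fderiv ℝ (partialDeriv l f)) x :=
      (hl.fderiv_right (m := ∞) le_rfl).differentiable (by simp) x
    have hs := (hl.contDiffAt (x := x)).isSymmSndFDerivAt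
      (by simpa using WithTop.coe_le_coe.2 (le_top : (2 : ℕ∞) ≤ ⊤))
    simp only [partialDeriv]
    rw [fderiv_clm_apply hd (by fun_prop), fderiv_clm_apply hd (by fun_prop)]
    simpa using hs _ _
  | trans _ _ ih₁ ih₂ => exact ih₁.trans ih₂

/-- The iterated partial derivative `∂_J f` along an unordered multi-index `J`. -/
def multiDeriv (J : Multiset (Fin p)) (f : (Fin p → ℝ) → ℝ) : (Fin p → ℝ) → ℝ :=
  partialDeriv (J.sort (· ≤ ·)) f

theorem partialDeriv_eq_multiDeriv {f : (Fin p → ℝ) → ℝ} (hf : ContDiff ℝ ∞ f)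
    (l : List (Fin p)) : partialDeriv l f = multiDeriv (l : Multiset (Fin p)) f :=
  partialDeriv_perm hf (Multiset.coe_eq_coe.1 (Multiset.sort_eq _ _).symm)

@[simp]
theorem multiDeriv_zero (f : (Fin p → ℝ) → ℝ) : multiDeriv 0 f = f := by
  simp [multiDeriv, partialDeriv]

theorem multiDeriv_cons {f : (Fin p → ℝ) → ℝ} (hf : ContDiff ℝ ∞ f) (i : Fin p)
    (J : Multiset (Fin p)) (x : Fin p → ℝ) :
    multiDeriv (i ::ₘ J) f x = fderiv ℝ (multiDeriv J f) x (Pi.single i 1) := by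
  change _ = partialDeriv (i :: J.sort (· ≤ ·)) f x
  rw [partialDeriv_eq_multiDeriv hf, ← Multiset.cons_coe, Multiset.sort_eq]

theorem contDiff_multiDeriv {f : (Fin p → ℝ) → ℝ} (hf : ContDiff ℝ ∞ f) (J : Multiset (Fin p)) :
    ContDiff ℝ ∞ (multiDeriv J f) :=
  contDiff_partialDeriv hf _

/-- Here the new derivative is innermost, whereas in `multiDeriv_cons` it is outermost; the two
agree because partial derivatives commute. -/
theorem multiDeriv_cons' {f : (Fin p → ℝ) → ℝ} (hf : ContDiff ℝ ∞ f) (i : Fin p)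
    (J : Multiset (Fin p)) :
    multiDeriv (i ::ₘ J) f = multiDeriv J (fun x => fderiv ℝ f x (Pi.single i 1)) := by
  have hf' : ContDiff ℝ ∞ (fun x => fderiv ℝ f x (Pi.single i 1)) :=
    (hf.fderiv_right (m := ∞) le_rfl).clm_apply contDiff_const
  induction J using Multiset.induction with
  | empty => funext x; rw [multiDeriv_cons hf]; simp
  | cons j J ih =>
    funext x
    rw [Multiset.cons_swap, multiDeriv_cons hf, ih, multiDeriv_cons hf']

theorem differentiable_multiDeriv {f : (Fin p → ℝ) → ℝ} (hf : ContDiff ℝ ∞ f)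
    (J : Multiset (Fin p)) : Differentiable ℝ (multiDeriv J f) :=
  (contDiff_multiDeriv hf J).differentiable (by simp)

theorem multiDeriv_const_mul {f : (Fin p → ℝ) → ℝ} (hf : ContDiff ℝ ∞ f) (c : ℝ)
    (J : Multiset (Fin p)) (x : Fin p → ℝ) :
    multiDeriv J (fun y => c * f y) x = c * multiDeriv J f x := by
  induction J using Multiset.induction generalizing x with
  | empty => simp
  | cons j J ih =>
    rw [multiDeriv_cons (contDiff_const.mul hf), funext ih, multiDeriv_cons hf,
      fderiv_const_mul (differentiable_multiDeriv hf J x)]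
    simp

theorem multiDeriv_sum {ι : Type*} (s : Finset ι) {f : ι → (Fin p → ℝ) → ℝ}
    (hf : ∀ i, ContDiff ℝ ∞ (f i)) (J : Multiset (Fin p)) (x : Fin p → ℝ) :
    multiDeriv J (fun y => ∑ i ∈ s, f i y) x = ∑ i ∈ s, multiDeriv J (f i) x := by
  induction J using Multiset.induction generalizing x with
  | empty => simp
  | cons j J ih =>
    rw [multiDeriv_cons (ContDiff.sum fun i _ => hf i), funext ih,
      fderiv_fun_sum fun i _ => differentiable_multiDeriv (hf i) J x]
    simp [multiDeriv_cons (hf _)]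

theorem multiDeriv_sub {f g : (Fin p → ℝ) → ℝ} (hf : ContDiff ℝ ∞ f) (hg : ContDiff ℝ ∞ g)
    (J : Multiset (Fin p)) (x : Fin p → ℝ) :
    multiDeriv J (fun y => f y - g y) x = multiDeriv J f x - multiDeriv J g x := by
  induction J using Multiset.induction generalizing x with
  | empty => simp
  | cons j J ih =>
    rw [multiDeriv_cons (hf.sub hg), funext ih, multiDeriv_cons hf, multiDeriv_cons hg,
      fderiv_fun_sub (differentiable_multiDeriv hf J x) (differentiable_multiDeriv hg J x)]
    simp

/-- The Leibniz rule for iterated partial derivatives. -/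
theorem multiDeriv_mul {ι : Type*} [DecidableEq ι] (J : ι → Fin p) (T : Finset ι)
    {f g : (Fin p → ℝ) → ℝ} (hf : ContDiff ℝ ∞ f) (hg : ContDiff ℝ ∞ g) (x : Fin p → ℝ) :
    multiDeriv (T.val.map J) (fun y => f y * g y) x =
      ∑ S ∈ T.powerset,
        multiDeriv (S.val.map J) f x * multiDeriv ((T \ S).val.map J) g x := by
  induction T using Finset.induction generalizing x with
  | empty => simp
  | insert t T ht ih =>
    rw [Finset.insert_val_of_notMem ht, Multiset.map_cons, multiDeriv_cons (hf.mul hg), funext ih,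
      fderiv_fun_sum fun S _ => (differentiable_multiDeriv hf _ x).fun_mul
        (differentiable_multiDeriv hg _ x),
      Finset.sum_powerset_insert ht, _root_.sum_apply, ← Finset.sum_add_distrib]
    -- Each `S ⊆ T` yields two subsets of `insert t T`: `S` when the new derivative falls on `g`,
    -- and `insert t S` when it falls on `f`.
    refine Finset.sum_congr rfl fun S hS => ?_
    have hS' := Finset.mem_powerset.1 hS
    have htS : t ∉ S := fun h => ht (hS' h)
    rw [fderiv_fun_mul (differentiable_multiDeriv hf _ x) (differentiable_multiDeriv hg _ x),
      Finset.insert_val_of_notMem htS, Multiset.map_cons, multiDeriv_cons hf,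
      Finset.insert_sdiff_of_notMem _ htS, Finset.insert_val_of_notMem (by simp [ht]),
      Multiset.map_cons, multiDeriv_cons hg]
    have : insert t T \ insert t S = T \ S := by
      ext a; simp only [Finset.mem_sdiff, Finset.mem_insert]; grind
    rw [this]
    simp
    ring

end PartialDeriv

/-! ### Functions with a prescribed jet -/

section Monomial

variable {p : ℕ}

/-- The monomial `∏_{j ∈ J} (x^j - x₀^j)`. -/
def monomialAt (x₀ : Fin p → ℝ) (J : Multiset (Fin p)) (x : Fin p → ℝ) : ℝ :=
  (J.map fun j => x j - x₀ j).prod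

theorem monomialAt_cons (x₀ : Fin p → ℝ) (i : Fin p) (J : Multiset (Fin p)) :
    monomialAt x₀ (i ::ₘ J) = fun x => (x i - x₀ i) * monomialAt x₀ J x := by
  funext x; simp [monomialAt]

theorem contDiff_monomialAt (x₀ : Fin p → ℝ) (J : Multiset (Fin p)) :
    ContDiff ℝ ∞ (monomialAt x₀ J) := by
  induction J using Multiset.induction with
  | empty =>
    have : monomialAt x₀ (0 : Multiset (Fin p)) = fun _ => 1 := by funext; simp [monomialAt]
    rw [this]
    exact contDiff_const
  | cons i J ih =>
    rw [monomialAt_cons]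
    exact (by fun_prop : ContDiff ℝ ∞ fun x : Fin p → ℝ => x i - x₀ i).mul ih

theorem monomialAt_self (x₀ : Fin p → ℝ) (J : Multiset (Fin p)) :
    monomialAt x₀ J x₀ = if J = 0 then 1 else 0 := by
  induction J using Multiset.induction with
  | empty => simp [monomialAt]
  | cons i J ih => simp [monomialAt_cons]

theorem fderiv_monomialAt (x₀ : Fin p → ℝ) (J : Multiset (Fin p)) (i : Fin p) (x : Fin p → ℝ) :
    fderiv ℝ (monomialAt x₀ J) x (Pi.single i 1) =
      J.count i * monomialAt x₀ (J.erase i) x := by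
  induction J using Multiset.induction with
  | empty =>
    have : monomialAt x₀ (0 : Multiset (Fin p)) = fun _ => 1 := by funext; simp [monomialAt]
    simp [this]
  | cons j J ih =>
    have hd : DifferentiableAt ℝ (monomialAt x₀ J) x :=
      (contDiff_monomialAt x₀ J).differentiable (by simp) x
    have h1 : HasFDerivAt (fun x : Fin p → ℝ => x j - x₀ j)
        (ContinuousLinearMap.proj (R := ℝ) (φ := fun _ : Fin p => ℝ) j) x :=
      (ContinuousLinearMap.proj (R := ℝ) (φ := fun _ : Fin p => ℝ) j).hasFDerivAt.sub_const _
    rw [monomialAt_cons, (h1.fun_mul hd.hasFDerivAt).fderiv]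
    simp only [_root_.add_apply, _root_.smul_apply, ih, smul_eq_mul,
      ContinuousLinearMap.proj_apply]
    rcases eq_or_ne i j with rfl | hij
    · simp only [Pi.single_eq_same, Multiset.count_cons_self, Multiset.erase_cons_head]
      by_cases hi : i ∈ J
      · have : monomialAt x₀ J x = (x i - x₀ i) * monomialAt x₀ (J.erase i) x := by
          conv_lhs => rw [← Multiset.cons_erase hi, monomialAt_cons]
        rw [this]; push_cast; ring
      · simp [Multiset.count_eq_zero_of_notMem hi]
    · rw [Multiset.count_cons_of_ne hij, Multiset.erase_cons_tail _ hij.symm, monomialAt_cons,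
        Pi.single_eq_of_ne hij.symm]
      ring

/-- The constant is a product of falling factorials, but only its vanishing matters. When `I ≤ J`
fails it is `0`, so the truncated difference `J - I` does no harm. -/
theorem multiDeriv_monomialAt (x₀ : Fin p → ℝ) (I J : Multiset (Fin p)) :
    ∃ c : ℝ, (c ≠ 0 ↔ I ≤ J) ∧ multiDeriv I (monomialAt x₀ J) = fun x =>
      c * monomialAt x₀ (J - I) x := by
  induction I using Multiset.induction generalizing J with
  | empty => exact ⟨1, by simp, by simp⟩
  | cons i I ih =>
    obtain ⟨c, hc, h⟩ := ih (J.erase i)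
    refine ⟨J.count i * c, ?_, ?_⟩
    · rw [mul_ne_zero_iff, hc, Nat.cast_ne_zero, ← Nat.pos_iff_ne_zero, Multiset.count_pos]
      constructor
      · rintro ⟨h1, h2⟩
        exact (Multiset.cons_le_cons i h2).trans_eq (Multiset.cons_erase h1)
      · intro h1
        have hi : i ∈ J := Multiset.mem_of_le h1 (Multiset.mem_cons_self i I)
        refine ⟨hi, ?_⟩
        rw [← Multiset.cons_erase hi] at h1
        exact (Multiset.cons_le_cons_iff i).1 h1
    · rw [multiDeriv_cons' (contDiff_monomialAt x₀ J)]
      funext x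
      simp_rw [fderiv_monomialAt]
      rw [multiDeriv_const_mul (contDiff_monomialAt x₀ _), h, Multiset.sub_cons]
      ring

/-- At the centre only the constant monomial survives, so `J - I = 0` is needed besides `I ≤ J`. Up
to nonzero factors, monomials are thus dual to the jet coordinates. -/
theorem multiDeriv_monomialAt_self_ne_zero (x₀ : Fin p → ℝ) (I J : Multiset (Fin p)) :
    multiDeriv I (monomialAt x₀ J) x₀ ≠ 0 ↔ I = J := by
  obtain ⟨c, hc, h⟩ := multiDeriv_monomialAt x₀ I J
  rw [congrFun h x₀, monomialAt_self, mul_ne_zero_iff, hc]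
  simp only [tsub_eq_zero_iff_le, ne_eq, ite_eq_right_iff, one_ne_zero, imp_false, not_not]
  exact le_antisymm_iff.symm

/-- Every point of the jet space is the jet of a smooth function. -/
theorem exists_jet_eq {q n : ℕ} (z : Jet p q n) :
    ∃ f : (Fin p → ℝ) → Fin q → ℝ, ContDiff ℝ ∞ f ∧ jet n f z.1 = z := by
  have hm := fun J : MultiIndex p n => contDiff_monomialAt z.1 J.1
  have hs : ∀ (α : Fin q) (J : MultiIndex p n), ContDiff ℝ ∞ fun y =>
      z.2 J α / multiDeriv J.1 (monomialAt z.1 J.1) z.1 * monomialAt z.1 J.1 y :=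
    fun α J => contDiff_const.mul (hm J)
  -- The Taylor polynomial of `z`; dividing by the derivative of the monomial itself avoids
  -- computing `J!`.
  refine ⟨fun x α => ∑ J : MultiIndex p n,
    z.2 J α / multiDeriv J.1 (monomialAt z.1 J.1) z.1 * monomialAt z.1 J.1 x, ?_, ?_⟩
  · exact contDiff_pi.2 fun α => ContDiff.sum fun J _ => hs α J
  · refine Prod.ext rfl (funext fun I => funext fun α => ?_)
    change multiDeriv I.1 (fun y => _) z.1 = _
    rw [multiDeriv_sum _ (hs α), Finset.sum_eq_single I]
    · rw [multiDeriv_const_mul (hm I),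
        div_mul_cancel₀ _ ((multiDeriv_monomialAt_self_ne_zero z.1 I.1 I.1).2 rfl)]
    · intro J _ hJ
      rw [multiDeriv_const_mul (hm J)]
      have := (multiDeriv_monomialAt_self_ne_zero z.1 I.1 J.1).not.2
        fun h => hJ (Subtype.ext h.symm)
      rw [not_not.1 this, mul_zero]
    · simp

end Monomial

/-! ### Total derivatives along jets -/

section TotalDeriv

variable {p q r n : ℕ}

theorem jet_snd_apply (m : ℕ) (f : (Fin p → ℝ) → Fin q → ℝ) (x : Fin p → ℝ) (J : MultiIndex p m)
    (α : Fin q) : (jet m f x).2 J α = multiDeriv J.1 (fun y => f y α) x :=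
  rfl

theorem jet_u {m : ℕ} (f : (Fin p → ℝ) → Fin q → ℝ) (x : Fin p → ℝ) {J : Multiset (Fin p)}
    (hJ : Multiset.card J ≤ m) (α : Fin q) :
    (jet m f x).u J α = multiDeriv J (fun y => f y α) x := by
  simp [Jet.u, hJ, jet_snd_apply]

theorem jet_proj {m k : ℕ} (h : k ≤ m) (f : (Fin p → ℝ) → Fin q → ℝ) (x : Fin p → ℝ) :
    (jet m f x).proj k = jet k f x :=
  Prod.ext rfl (funext fun J => funext fun α => jet_u f x (J.2.trans h) α)

theorem jet_base {m : ℕ} (f : (Fin p → ℝ) → Fin q → ℝ) (x : Fin p → ℝ) :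
    (jet m f x).base = (x, f x) :=
  Prod.ext rfl (funext fun α => by
    simp only [Jet.base, jet_snd_apply, multiDeriv_zero])

theorem contDiff_apply_component {f : (Fin p → ℝ) → Fin q → ℝ} (hf : ContDiff ℝ ∞ f)
    (α : Fin q) : ContDiff ℝ ∞ fun y => f y α :=
  contDiff_pi.1 hf α

theorem contDiff_jet (m : ℕ) {f : (Fin p → ℝ) → Fin q → ℝ} (hf : ContDiff ℝ ∞ f) :
    ContDiff ℝ ∞ (jet m f) :=
  contDiff_id.prodMk <| contDiff_pi.2 fun J => contDiff_pi.2 fun α =>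
    contDiff_multiDeriv (contDiff_apply_component hf α) J.1

theorem fderiv_jet_single (m : ℕ) {f : (Fin p → ℝ) → Fin q → ℝ} (hf : ContDiff ℝ ∞ f)
    (x : Fin p → ℝ) (i : Fin p) :
    fderiv ℝ (jet m f) x (Pi.single i 1) =
      (Pi.single i 1, fun J α => multiDeriv (i ::ₘ J.1) (fun y => f y α) x) := by
  have h : HasFDerivAt (jet m f)
      ((ContinuousLinearMap.id ℝ (Fin p → ℝ)).prod
        (ContinuousLinearMap.pi fun J : MultiIndex p m => ContinuousLinearMap.pi fun α =>
          fderiv ℝ (multiDeriv J.1 fun y => f y α) x)) x :=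
    (hasFDerivAt_id x).prodMk <| hasFDerivAt_pi.2 fun J => hasFDerivAt_pi.2 fun α =>
      (differentiable_multiDeriv (contDiff_apply_component hf α) J.1 x).hasFDerivAt
  rw [h.fderiv]
  refine Prod.ext rfl (funext fun J => funext fun α => ?_)
  simp [multiDeriv_cons (contDiff_apply_component hf α)]

/-- The chain rule: along `x ↦ jet m f x` the coordinate `u_J` has `i`-th partial derivative
`u_{J,i}`, which is exactly its coefficient in `D_i`. -/
theorem totalDeriv_jet {m : ℕ} {P : Jet p q m → ℝ} (hP : Differentiable ℝ P)
    {f : (Fin p → ℝ) → Fin q → ℝ} (hf : ContDiff ℝ ∞ f) (i : Fin p) (x : Fin p → ℝ) :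
    totalDeriv i P (jet (m + 1) f x) = fderiv ℝ (fun y => P (jet m f y)) x (Pi.single i 1) := by
  have hc : fderiv ℝ (fun y => P (jet m f y)) x =
      (fderiv ℝ P (jet m f x)).comp (fderiv ℝ (jet m f) x) :=
    fderiv_comp x (hP _) ((contDiff_jet m hf).differentiable (by simp) x)
  rw [hc, ContinuousLinearMap.comp_apply, fderiv_jet_single m hf]
  set h : MultiIndex p m → Fin q → ℝ := fun J α => multiDeriv (i ::ₘ J.1) (fun y => f y α) x
    with hh
  have hdec : ((Pi.single i 1, h) : Jet p q m) = (Pi.single i 1, 0) +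
      ∑ α : Fin q, ∑ J : MultiIndex p m,
        h J α • ((0, Pi.single J (Pi.single α 1)) : Jet p q m) := by
    refine Prod.ext ?_ (funext fun J => funext fun α => ?_)
    · simp [Prod.fst_sum]
    · simp only [Prod.snd_add, Prod.snd_sum, Prod.smul_snd, zero_add,
        Finset.sum_apply, Pi.smul_apply, smul_eq_mul]
      rw [Finset.sum_eq_single α, Finset.sum_eq_single J]
      · simp
      · intro J' _ hJ'; simp [Pi.single_eq_of_ne hJ'.symm]
      · simp
      · intro β _ hβ
        refine Finset.sum_eq_zero fun J' _ => ?_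
        rcases eq_or_ne J J' with rfl | hJ'
        · simp [Pi.single_eq_of_ne hβ.symm]
        · simp [Pi.single_eq_of_ne hJ']
      · simp
  rw [hdec, map_add, map_sum, totalDeriv, jet_proj (Nat.le_succ m)]
  simp_rw [map_sum, map_smul, smul_eq_mul]
  congr 1
  refine Finset.sum_congr rfl fun α _ => Finset.sum_congr rfl fun J _ => ?_
  -- The order of `i ::ₘ J` is at most `m + 1`, so the default value `0` of `Jet.u` does not
  -- intervene.
  rw [jet_u f x (by simpa using J.2)]

theorem contDiff_jetU {m : ℕ} (J : Multiset (Fin p)) (α : Fin q) :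
    ContDiff ℝ ∞ fun z : Jet p q m => z.u J α := by
  unfold Jet.u
  split_ifs with h
  · fun_prop
  · exact contDiff_const

theorem contDiff_jetProj {m : ℕ} (k : ℕ) : ContDiff ℝ ∞ fun z : Jet p q m => z.proj k :=
  contDiff_fst.prodMk <| contDiff_pi.2 fun J => contDiff_pi.2 fun α => contDiff_jetU J.1 α

theorem contDiff_totalDeriv {m : ℕ} {P : Jet p q m → ℝ} (hP : ContDiff ℝ ∞ P) (i : Fin p) :
    ContDiff ℝ ∞ (totalDeriv i P) := by
  have h := fun v : Jet p q m => ((hP.fderiv_right (m := ∞) le_rfl).comp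
    (contDiff_jetProj (m := m + 1) m)).clm_apply (contDiff_const (c := v))
  exact (h _).add <| ContDiff.sum fun α _ => ContDiff.sum fun J _ =>
    (contDiff_jetU (i ::ₘ J.1) α).mul (h _)

theorem contDiff_totalDerivList {m : ℕ} {P : Jet p q m → ℝ} (hP : ContDiff ℝ ∞ P)
    (J : List (Fin p)) : ContDiff ℝ ∞ (totalDerivList P J) := by
  induction J with
  | nil => exact hP
  | cons j l ih => exact contDiff_totalDeriv ih j

theorem totalDerivList_jet {m : ℕ} {P : Jet p q m → ℝ} (hP : ContDiff ℝ ∞ P)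
    {f : (Fin p → ℝ) → Fin q → ℝ} (hf : ContDiff ℝ ∞ f) (J : List (Fin p)) (x : Fin p → ℝ) :
    totalDerivList P J (jet (m + J.length) f x) = partialDeriv J (fun y => P (jet m f y)) x := by
  induction J generalizing x with
  | nil => rfl
  | cons j l ih =>
    change totalDeriv j (totalDerivList P l) (jet (m + l.length + 1) f x) = _
    rw [totalDeriv_jet ((contDiff_totalDerivList hP l).differentiable (by simp)) hf, funext ih]
    rfl

theorem contDiff_jetBase {m : ℕ} : ContDiff ℝ ∞ fun z : Jet p q m => z.base := by
  unfold Jet.base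
  fun_prop

theorem totalDerivLibrary_jet {Θ : Total p q → Fin r → ℝ} (hΘ : ContDiff ℝ ∞ Θ)
    {f : (Fin p → ℝ) → Fin q → ℝ} (hf : ContDiff ℝ ∞ f) {J : List (Fin p)} (hJ : J.length ≤ n)
    (x : Fin p → ℝ) (a : Fin r) :
    totalDerivLibrary Θ J (jet n f x) a =
      multiDeriv (J : Multiset (Fin p)) (fun y => Θ (y, f y) a) x := by
  have hP : ContDiff ℝ ∞ fun w : Jet p q 0 => Θ w.base a :=
    (contDiff_pi.1 hΘ a).comp contDiff_jetBase
  have hc : ContDiff ℝ ∞ fun y => Θ (y, f y) a :=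
    (contDiff_pi.1 hΘ a).comp (contDiff_id.prodMk hf)
  rw [totalDerivLibrary, jet_proj (by simpa using hJ), totalDerivList_jet hP hf]
  simp_rw [jet_base]
  rw [partialDeriv_eq_multiDeriv hc]

theorem totalDerivLibrary_jet_dotProduct {Θ : Total p q → Fin r → ℝ} (hΘ : ContDiff ℝ ∞ Θ)
    {f : (Fin p → ℝ) → Fin q → ℝ} (hf : ContDiff ℝ ∞ f) {J : List (Fin p)} (hJ : J.length ≤ n)
    (x : Fin p → ℝ) (w : Fin r → ℝ) :
    totalDerivLibrary Θ J (jet n f x) ⬝ᵥ w =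
      multiDeriv (J : Multiset (Fin p)) (fun y => Θ (y, f y) ⬝ᵥ w) x := by
  have hc : ∀ a, ContDiff ℝ ∞ fun y => Θ (y, f y) a := fun a =>
    (contDiff_pi.1 hΘ a).comp (contDiff_id.prodMk hf)
  simp_rw [dotProduct, mul_comm _ (w _)]
  rw [multiDeriv_sum _ fun a => contDiff_const.mul (hc a)]
  refine Finset.sum_congr rfl fun a _ => ?_
  rw [multiDeriv_const_mul (hc a), totalDerivLibrary_jet hΘ hf hJ]

theorem coe_subtuple {k : ℕ} (J : Fin k → Fin p) (S : Finset (Fin k)) :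
    (subtuple J S : Multiset (Fin p)) = S.val.map J := by
  rw [subtuple, ← Multiset.map_coe, Finset.sort_eq]

theorem length_subtuple {k : ℕ} (J : Fin k → Fin p) (S : Finset (Fin k)) :
    (subtuple J S).length = S.card := by
  simp [subtuple]

/-- The prolongation coefficients at the jet of `f`, in terms of the characteristic
`Q^α = Θᵀ W_{p+α} - ∑_i ∂_i f^α Θᵀ W_i` along the graph of `f`. -/
theorem prolongationCoeff_jet {Θ : Total p q → Fin r → ℝ} (hΘ : ContDiff ℝ ∞ Θ)
    (W : Matrix (Fin (p + q)) (Fin r) ℝ)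
    {f : (Fin p → ℝ) → Fin q → ℝ} (hf : ContDiff ℝ ∞ f) {k : ℕ} (hk : k ≤ n)
    (J : Fin k → Fin p) (α : Fin q) (x : Fin p → ℝ) :
    prolongationCoeff W Θ J α (jet n f x) =
      multiDeriv (Finset.univ.val.map J) (fun y => (libraryField W Θ (y, f y)).2 α -
        ∑ i, fderiv ℝ (fun y => f y α) y (Pi.single i 1) * (libraryField W Θ (y, f y)).1 i) x +
      ∑ i, multiDeriv (i ::ₘ Finset.univ.val.map J) (fun y => f y α) x *
        (libraryField W Θ (x, f x)).1 i := by
  have hfα := contDiff_apply_component hf α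
  have hd : ∀ i, ContDiff ℝ ∞ fun y => fderiv ℝ (fun y => f y α) y (Pi.single i 1) :=
    fun i => (hfα.fderiv_right (m := ∞) le_rfl).clm_apply contDiff_const
  have hc : ∀ w : Fin r → ℝ, ContDiff ℝ ∞ fun y => Θ (y, f y) ⬝ᵥ w := fun w =>
    ContDiff.sum fun a _ =>
      ((contDiff_pi.1 hΘ a).comp (contDiff_id.prodMk hf)).mul contDiff_const
  have hcard : ∀ S : Finset (Fin k), (subtuple J S).length ≤ n := fun S => by
    rw [length_subtuple]
    exact (S.card_le_univ.trans_eq (by simp)).trans hk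
  simp only [libraryField]
  rw [multiDeriv_sub (hc _) (ContDiff.sum fun i _ => (hd i).mul (hc _)),
    multiDeriv_sum _ fun i => (hd i).mul (hc _), prolongationCoeff,
    totalDerivLibrary_jet_dotProduct hΘ hf (hcard _), coe_subtuple]
  -- In the Leibniz rule, `S` is the set of positions differentiating `∂_i f`. The term `S = univ`
  -- is split off; it will cancel the last sum of the statement.
  have key : ∀ i, multiDeriv (Finset.univ.val.map J) (fun y =>
        fderiv ℝ (fun y => f y α) y (Pi.single i 1) * Θ (y, f y) ⬝ᵥ W (Fin.castAdd q i)) x =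
      ∑ S ∈ (Finset.univ : Finset (Fin k)).ssubsets,
        (jet n f x).u (i ::ₘ (subtuple J S : Multiset (Fin p))) α *
          (totalDerivLibrary Θ (subtuple J Sᶜ) (jet n f x) ⬝ᵥ W (Fin.castAdd q i)) +
      multiDeriv (i ::ₘ Finset.univ.val.map J) (fun y => f y α) x *
        Θ (x, f x) ⬝ᵥ W (Fin.castAdd q i) := by
    intro i
    rw [multiDeriv_mul J Finset.univ (hd i) (hc _), Finset.ssubsets,
      ← Finset.sum_erase_add _ _ (Finset.mem_powerset_self _), ← multiDeriv_cons' hfα]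
    congr 1
    · refine Finset.sum_congr rfl fun S hS => ?_
      -- Properness of `S` leaves room for the extra index `i`: the order `S.card + 1` is at most
      -- `n`, so `u_{I,i}` is a genuine coordinate of the jet.
      have hS' : S.card < k := by
        have := Finset.card_lt_card (Finset.mem_ssubsets.1 hS)
        simpa using this
      rw [totalDerivLibrary_jet_dotProduct hΘ hf (hcard _), coe_subtuple, coe_subtuple,
        jet_u f x (by simp; omega), multiDeriv_cons' hfα, Finset.compl_eq_univ_sdiff]
    · simp
  simp_rw [key, Finset.sum_add_distrib]
  ring

end TotalDeriv

/-! ### Taylor coefficients and jets -/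

section TaylorEq

variable {X Y Z : Type*} [NormedAddCommGroup X] [NormedSpace ℝ X] [NormedAddCommGroup Y]
  [NormedSpace ℝ Y] [NormedAddCommGroup Z] [NormedSpace ℝ Z] {n : ℕ}

/-- `a` and `b` have the same derivatives up to order `n` at `x`. -/
def TaylorEq (n : ℕ) (x : X) (a b : X → Y) : Prop :=
  ∀ k ≤ n, iteratedFDeriv ℝ k a x = iteratedFDeriv ℝ k b x

theorem TaylorEq.symm {x : X} {a b : X → Y} (h : TaylorEq n x a b) : TaylorEq n x b a :=
  fun k hk => (h k hk).symm

theorem TaylorEq.trans {x : X} {a b c : X → Y} (h : TaylorEq n x a b) (h' : TaylorEq n x b c) :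
    TaylorEq n x a c :=
  fun k hk => (h k hk).trans (h' k hk)

theorem TaylorEq.of_eventuallyEq {x : X} {a b : X → Y} (h : a =ᶠ[𝓝 x] b) : TaylorEq n x a b :=
  fun k _ => (h.iteratedFDeriv ℝ k).eq_of_nhds

theorem TaylorEq.eq {x : X} {a b : X → Y} (h : TaylorEq n x a b) : a x = b x := by
  have := congrArg (fun L => L 0) (h 0 (Nat.zero_le n))
  simpa using this

/-- Faà di Bruno: the derivatives of a composite up to order `n` are expressed through those of its
factors up to order `n`. -/
theorem TaylorEq.comp {x : X} {a b : X → Y} {F G : Y → Z} (ha : ContDiffAt ℝ n a x)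
    (hb : ContDiffAt ℝ n b x) (hF : ContDiffAt ℝ n F (a x)) (hG : ContDiffAt ℝ n G (a x))
    (hFG : TaylorEq n (a x) F G) (hab : TaylorEq n x a b) :
    TaylorEq n x (fun y => F (a y)) (fun y => G (b y)) := by
  intro k hk
  have hG' : ContDiffAt ℝ n G (b x) := by rwa [← hab.eq]
  change iteratedFDeriv ℝ k (F ∘ a) x = iteratedFDeriv ℝ k (G ∘ b) x
  rw [iteratedFDeriv_comp hF ha (by exact_mod_cast hk),
    iteratedFDeriv_comp hG' hb (by exact_mod_cast hk)]
  refine Finset.sum_congr rfl fun c _ => ?_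
  have h1 : ftaylorSeries ℝ F (a x) c.length = ftaylorSeries ℝ G (b x) c.length := by
    rw [← hab.eq]
    exact hFG _ (c.length_le.trans hk)
  have h2 : (fun i => ftaylorSeries ℝ a x (c.partSize i)) =
      fun i => ftaylorSeries ℝ b x (c.partSize i) :=
    funext fun i => hab _ ((c.partSize_le i).trans hk)
  change c.compAlongOrderedFinpartition (ftaylorSeries ℝ F (a x) c.length)
      (fun i => ftaylorSeries ℝ a x (c.partSize i)) =
    c.compAlongOrderedFinpartition (ftaylorSeries ℝ G (b x) c.length)
      (fun i => ftaylorSeries ℝ b x (c.partSize i))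
  rw [h1, h2]

theorem TaylorEq.graph {x : X} {a b : X → Y} (ha : ContDiffAt ℝ n a x)
    (hb : ContDiffAt ℝ n b x) (hab : TaylorEq n x a b) :
    TaylorEq n x (fun y => (y, a y)) (fun y => (y, b y)) := by
  intro k hk
  have hk' : (k : ℕ∞ω) ≤ n := by exact_mod_cast hk
  have h1 := iteratedFDeriv_prodMk (contDiffAt_id (n := (n : ℕ∞ω)) (x := x)) ha hk'
  have h2 := iteratedFDeriv_prodMk (contDiffAt_id (n := (n : ℕ∞ω)) (x := x)) hb hk'
  rw [hab k hk] at h1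
  exact h1.trans h2.symm

end TaylorEq

section JetTaylor

variable {p q n : ℕ}

theorem iteratedFDeriv_apply_component {f : (Fin p → ℝ) → Fin q → ℝ} {x : Fin p → ℝ} {k : ℕ}
    (hf : ContDiffAt ℝ k f x) (α : Fin q) (m : Fin k → Fin p → ℝ) :
    iteratedFDeriv ℝ k f x m α = iteratedFDeriv ℝ k (fun y => f y α) x m := by
  have := (ContinuousLinearMap.proj (R := ℝ) (φ := fun _ : Fin q => ℝ) α).iteratedFDeriv_comp_left
    hf le_rfl
  exact (congrArg (fun L => L m) this).symm

/-- A multilinear map is determined by its values on tuples of basis vectors, and for the iterated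
derivatives these are jet coordinates. -/
theorem taylorEq_of_jet_eq {f g : (Fin p → ℝ) → Fin q → ℝ} (hf : ContDiff ℝ ∞ f)
    (hg : ContDiff ℝ ∞ g) {x : Fin p → ℝ} (h : jet n f x = jet n g x) : TaylorEq n x f g := by
  intro k hk
  have hk' : (k : ℕ∞ω) ≤ ∞ := by exact_mod_cast (le_top : (k : ℕ∞) ≤ ⊤)
  refine ContinuousMultilinearMap.toMultilinearMap_injective ?_
  refine Module.Basis.ext_multilinear (fun _ => Pi.basisFun ℝ (Fin p)) fun v => ?_
  funext α
  have key : ∀ {f : (Fin p → ℝ) → Fin q → ℝ}, ContDiff ℝ ∞ f →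
      iteratedFDeriv ℝ k f x (fun i => Pi.basisFun ℝ (Fin p) (v i)) α =
        (jet n f x).u (List.ofFn v : Multiset (Fin p)) α := by
    intro f hf
    have hfα := contDiff_apply_component hf α
    rw [jet_u f x (by simpa using hk), ← partialDeriv_eq_multiDeriv hfα,
      iteratedFDeriv_apply_component (hf.contDiffAt.of_le hk'),
      partialDeriv_eq_iteratedFDeriv _ (hfα.contDiffAt.of_le (by
        exact_mod_cast (le_top : ((List.ofFn v).length : ℕ∞) ≤ ⊤)))]
    -- The length of `List.ofFn v` is only propositionally `k`; a variable `l` allows the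
    -- substitution.
    have : ∀ (l : ℕ) (hl : l = k) (w : Fin l → Fin p) (hw : ∀ i, w i = v (Fin.cast hl i)),
        iteratedFDeriv ℝ k (fun y => f y α) x (fun i => Pi.basisFun ℝ (Fin p) (v i)) =
          iteratedFDeriv ℝ l (fun y => f y α) x (fun s => Pi.single (w s) (1 : ℝ)) := by
      rintro l rfl w hw
      congr 1
      funext i
      simp [hw]
    exact this _ (by simp) _ (fun i => by simp; rfl)
  change iteratedFDeriv ℝ k f x _ α = iteratedFDeriv ℝ k g x _ α
  rw [key hf, key hg, h]

theorem jet_eq_of_taylorEq {f g : (Fin p → ℝ) → Fin q → ℝ} {x : Fin p → ℝ}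
    (hf : ContDiffAt ℝ ∞ f x) (hg : ContDiffAt ℝ ∞ g x) (h : TaylorEq n x f g) :
    jet n f x = jet n g x := by
  refine Prod.ext rfl (funext fun J => funext fun α => ?_)
  have hl : (J.1.sort (· ≤ ·)).length ≤ n := by simpa using J.2
  have hl' : ((J.1.sort (· ≤ ·)).length : ℕ∞ω) ≤ ∞ := by
    exact_mod_cast (le_top : ((J.1.sort (· ≤ ·)).length : ℕ∞) ≤ ⊤)
  change partialDeriv (J.1.sort (· ≤ ·)) _ x = partialDeriv (J.1.sort (· ≤ ·)) _ x
  rw [partialDeriv_eq_iteratedFDeriv _ ((contDiffAt_pi.1 hf α).of_le hl'),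
    partialDeriv_eq_iteratedFDeriv _ ((contDiffAt_pi.1 hg α).of_le hl'),
    ← iteratedFDeriv_apply_component (hf.of_le hl'), ← iteratedFDeriv_apply_component
    (hg.of_le hl'), h _ hl]

end JetTaylor

/-! ### Uniqueness of the prolongation -/

namespace LieGroupAction

variable {E G M : Type*} [NormedAddCommGroup E] [NormedSpace ℝ E]
  [TopologicalSpace G] [ChartedSpace E G] [Group G] [NormedAddCommGroup M] [NormedSpace ℝ M]

theorem eventually_mem_domain (A : LieGroupAction E G M) {g : G} {y : M}
    (h : (g, y) ∈ A.domain) : ∀ᶠ w in 𝓝 y, (g, w) ∈ A.domain :=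
  (Continuous.prodMk_right g).continuousAt.eventually (A.isOpen_domain.mem_nhds h)

theorem contDiffAt_act (A : LieGroupAction E G M) {g : G} {y : M} (h : (g, y) ∈ A.domain) :
    ContDiffAt ℝ ∞ (A.act g) y := by
  rw [← contMDiffAt_iff_contDiffAt]
  have h1 : ContMDiffAt (𝓘(ℝ, E).prod 𝓘(ℝ, M)) 𝓘(ℝ, M) ∞
      (fun z : G × M => A.act z.1 z.2) (g, y) :=
    (A.smooth _ h).contMDiffAt (A.isOpen_domain.mem_nhds h)
  have h2 : ContMDiffAt 𝓘(ℝ, M) (𝓘(ℝ, E).prod 𝓘(ℝ, M)) ∞ (fun w : M => (g, w)) y :=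
    contMDiffAt_const.prodMk contMDiffAt_id
  exact h1.comp (x := y) h2

variable {p q n : ℕ}

/-- `f'` is a smooth transform of `f` by `g` near the image of the point `y₀` of the graph. -/
structure IsTransform (A : LieGroupAction E G (Total p q)) (g : G) (y₀ : Total p q)
    (f f' : (Fin p → ℝ) → Fin q → ℝ) : Prop where
  mem : (g, y₀) ∈ A.domain
  smooth : ContDiff ℝ ∞ f
  graph : f y₀.1 = y₀.2
  smooth' : ContDiffAt ℝ ∞ f' (A.act g y₀).1
  image_iff : ∀ᶠ y in 𝓝 (A.act g y₀), y ∈ A.image g {w | w.2 = f w.1} ↔ y.2 = f' y.1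

namespace IsTransform

variable {A : LieGroupAction E G (Total p q)} {g : G} {y₀ : Total p q}
  {f f' : (Fin p → ℝ) → Fin q → ℝ}

theorem contDiffAt_act_graph (h : IsTransform A g y₀ f f') :
    ContDiffAt ℝ ∞ (fun x => A.act g (x, f x)) y₀.1 := by
  have h1 : ContDiffAt ℝ ∞ (A.act g) (y₀.1, f y₀.1) := by
    rw [h.graph]; exact A.contDiffAt_act h.mem
  exact h1.comp y₀.1 (contDiffAt_id.prodMk h.smooth.contDiffAt)

/-- By continuity, `g` carries nearby points of the graph of `f` into the region where `g · Γ_f` is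
the graph of `f'`. This gives `f' ∘ φ = ψ`. -/
theorem eventually_comp (h : IsTransform A g y₀ f f') :
    ∀ᶠ x in 𝓝 y₀.1, f' (A.act g (x, f x)).1 = (A.act g (x, f x)).2 := by
  have hc : ContinuousAt (fun x => (x, f x)) y₀.1 :=
    continuousAt_id.prodMk h.smooth.continuous.continuousAt
  have h0 : (y₀.1, f y₀.1) = y₀ := by rw [h.graph]
  have hmem := hc.eventually (h0.symm ▸ A.eventually_mem_domain h.mem)
  have him := h.contDiffAt_act_graph.continuousAt.eventually
    (p := fun y => y ∈ A.image g {w | w.2 = f w.1} ↔ y.2 = f' y.1)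
    (by simpa only [h0] using h.image_iff)
  filter_upwards [hmem, him] with x hx hx'
  exact (hx'.1 ⟨(x, f x), rfl, hx, rfl⟩).symm

theorem apply_base (h : IsTransform A g y₀ f f') : f' (A.act g y₀).1 = (A.act g y₀).2 := by
  have h0 : (y₀.1, f y₀.1) = y₀ := by rw [h.graph]
  simpa [h0] using h.eventually_comp.self_of_nhds

theorem contDiffAt_inv (h : IsTransform A g y₀ f f') :
    ContDiffAt ℝ ∞ (fun x => A.act g⁻¹ (x, f' x)) (A.act g y₀).1 := by
  have h1 : ContDiffAt ℝ ∞ (A.act g⁻¹) ((A.act g y₀).1, f' (A.act g y₀).1) := by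
    rw [h.apply_base]
    exact A.contDiffAt_act (A.inv_mem g y₀ h.mem)
  exact h1.comp (A.act g y₀).1 (contDiffAt_id.prodMk h.smooth')

theorem inv_base (h : IsTransform A g y₀ f f') :
    A.act g⁻¹ ((A.act g y₀).1, f' (A.act g y₀).1) = y₀ := by
  rw [h.apply_base]
  exact A.inv_act g y₀ h.mem

/-- The converse inclusion: `(x, f' x)` lies on `g · Γ_f`, and `g⁻¹` returns it to the graph of `f`.
So `χ x = (g⁻¹ · (x, f' x)).1` is a local smooth right inverse of `φ`, obtained without inverting
any derivative. -/
theorem eventually_inv (h : IsTransform A g y₀ f f') :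
    ∀ᶠ x in 𝓝 (A.act g y₀).1,
      (A.act g ((A.act g⁻¹ (x, f' x)).1, f (A.act g⁻¹ (x, f' x)).1)).1 = x := by
  have hc : ContinuousAt (fun x => (x, f' x)) (A.act g y₀).1 :=
    continuousAt_id.prodMk h.smooth'.continuousAt
  have h0 : ((A.act g y₀).1, f' (A.act g y₀).1) = A.act g y₀ := by rw [h.apply_base]
  have him := hc.eventually (h0.symm ▸ h.image_iff)
  filter_upwards [him] with x hx
  obtain ⟨w, hw, hwd, hwe⟩ := hx.2 rfl
  have hw' : (w.1, f w.1) = w := Prod.ext rfl (Eq.symm hw)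
  rw [← hwe, A.inv_act g w hwd, hw', hwe]

/-- Write `φ_f, ψ_f` and `φ_k, ψ_k` for the components of `g` on the two graphs. To order `n`, `f' ∘
φ_f = ψ_f` agrees with `ψ_k = k' ∘ φ_k`, hence with `k' ∘ φ_f`. Composing with the right inverse `χ`
of `φ_f` leaves `f'` and `k'`. -/
theorem jet_unique {k k' : (Fin p → ℝ) → Fin q → ℝ} (h : IsTransform A g y₀ f f')
    (hk : IsTransform A g y₀ k k') (hfk : jet n f y₀.1 = jet n k y₀.1) :
    jet n f' (A.act g y₀).1 = jet n k' (A.act g y₀).1 := by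
  have hn : ((n : ℕ) : ℕ∞ω) ≤ ∞ := by exact_mod_cast (le_top : (n : ℕ∞) ≤ ⊤)
  have h0 : (y₀.1, f y₀.1) = y₀ := by rw [h.graph]
  have h0k : (y₀.1, k y₀.1) = y₀ := by rw [hk.graph]
  have hf := h.contDiffAt_act_graph.of_le hn
  have hkk := hk.contDiffAt_act_graph.of_le hn
  have hact : TaylorEq n y₀.1 (fun x => A.act g (x, f x)) (fun x => A.act g (x, k x)) := by
    have hA : ContDiffAt ℝ n (A.act g) (y₀.1, f y₀.1) := by
      rw [h0]; exact (A.contDiffAt_act h.mem).of_le hn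
    have hfn := h.smooth.contDiffAt.of_le (x := y₀.1) hn
    have hkn := hk.smooth.contDiffAt.of_le (x := y₀.1) hn
    exact .comp (contDiffAt_id.prodMk hfn) (contDiffAt_id.prodMk hkn) hA hA (fun _ _ => rfl)
      ((taylorEq_of_jet_eq h.smooth hk.smooth hfk).graph hfn hkn)
  have h1 : TaylorEq n y₀.1 (fun x => (A.act g (x, f x)).1) (fun x => (A.act g (x, k x)).1) :=
    .comp hf hkk contDiffAt_fst contDiffAt_fst (fun _ _ => rfl) hact
  have h2 : TaylorEq n y₀.1 (fun x => (A.act g (x, f x)).2) (fun x => (A.act g (x, k x)).2) :=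
    .comp hf hkk contDiffAt_snd contDiffAt_snd (fun _ _ => rfl) hact
  have hf'n : ContDiffAt ℝ n f' (A.act g (y₀.1, f y₀.1)).1 := by
    rw [h0]; exact h.smooth'.of_le hn
  have hk'n : ContDiffAt ℝ n k' (A.act g (y₀.1, f y₀.1)).1 := by
    rw [h0]; exact hk.smooth'.of_le hn
  have h3 : TaylorEq n y₀.1 (fun x => f' (A.act g (x, f x)).1)
      (fun x => k' (A.act g (x, f x)).1) :=
    ((TaylorEq.of_eventuallyEq h.eventually_comp).trans h2).trans <|
      (TaylorEq.of_eventuallyEq hk.eventually_comp).symm.trans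
      (TaylorEq.comp hf.fst hkk.fst hk'n hk'n (fun _ _ => rfl) h1).symm
  have hχ : ContDiffAt ℝ n (fun x => (A.act g⁻¹ (x, f' x)).1) (A.act g y₀).1 :=
    (h.contDiffAt_inv.of_le hn).fst
  have hχ0 : (A.act g⁻¹ ((A.act g y₀).1, f' (A.act g y₀).1)).1 = y₀.1 := by rw [h.inv_base]
  have hcomp : ∀ {F : (Fin p → ℝ) → Fin q → ℝ}, ContDiffAt ℝ n F (A.act g (y₀.1, f y₀.1)).1 →
      ContDiffAt ℝ n (fun x => F (A.act g (x, f x)).1)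
        (A.act g⁻¹ ((A.act g y₀).1, f' (A.act g y₀).1)).1 := fun hF => by
    rw [hχ0]
    exact ContDiffAt.comp y₀.1 hF hf.fst
  have h4 := TaylorEq.comp hχ hχ (hcomp hf'n) (hcomp hk'n) (by rw [hχ0]; exact h3)
    (fun _ _ => rfl)
  have hid : ∀ F : (Fin p → ℝ) → Fin q → ℝ,
      (fun x => F (A.act g ((A.act g⁻¹ (x, f' x)).1, f (A.act g⁻¹ (x, f' x)).1)).1)
        =ᶠ[𝓝 (A.act g y₀).1] F := fun F => by
    filter_upwards [h.eventually_inv] with x hx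
    rw [hx]
  exact jet_eq_of_taylorEq h.smooth' hk.smooth' <|
    (TaylorEq.of_eventuallyEq (hid f')).symm.trans (h4.trans (.of_eventuallyEq (hid k')))

end IsTransform

theorem isProlongation_unique {A : LieGroupAction E G (Total p q)} {g : G} {z z₁ z₂ : Jet p q n}
    (h₁ : A.IsProlongation n g z z₁) (h₂ : A.IsProlongation n g z z₂) : z₁ = z₂ := by
  have key : ∀ {z' : Jet p q n}, A.IsProlongation n g z z' → ∃ f f',
      IsTransform A g z.base f f' ∧ jet n f z.1 = z ∧ z' = jet n f' (A.act g z.base).1 := by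
    rintro z' ⟨hd, f, f', hf, hj, hf', him, hz'⟩
    refine ⟨f, f', ⟨hd, hf, ?_, hf'.self_of_nhds, him⟩, hj, hz'⟩
    have := congrArg (fun w : Jet p q n => w.base.2) hj
    rw [jet_base] at this
    exact this
  obtain ⟨f, f', h, hj, rfl⟩ := key h₁
  obtain ⟨k, k', hk, hjk, rfl⟩ := key h₂
  exact h.jet_unique hk (hj.trans hjk.symm)

end LieGroupAction

/-! ### Derivatives of the transforms of a function by a family of transformations -/

section TransDeriv

variable {P : Type*} [NormedAddCommGroup P] [NormedSpace ℝ P] {p : ℕ}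

/-- The partial derivative with respect to the second variable. -/
def sndDeriv (F : P × (Fin p → ℝ) → Fin p → ℝ) (w : P × (Fin p → ℝ)) :
    (Fin p → ℝ) →L[ℝ] (Fin p → ℝ) :=
  (fderiv ℝ F w).comp (ContinuousLinearMap.inr ℝ P (Fin p → ℝ))

/-- The derivatives `∂_J f_a (φ_a x)` of the functions `f_a` with `f_a (φ_a x) = ψ_a x`, as
functions of `(a, x)`, computed from `φ` and `ψ` by the chain rule. -/
def transDeriv (φ : P × (Fin p → ℝ) → Fin p → ℝ) (ψ : P × (Fin p → ℝ) → ℝ) :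
    List (Fin p) → P × (Fin p → ℝ) → ℝ
  | [] => ψ
  | j :: l => fun w =>
      fderiv ℝ (transDeriv φ ψ l) w (0, (sndDeriv φ w).inverse (Pi.single j 1))

variable {φ : P × (Fin p → ℝ) → Fin p → ℝ} {ψ : P × (Fin p → ℝ) → ℝ} {w : P × (Fin p → ℝ)}

theorem contDiffAt_sndDeriv (hφ : ContDiffAt ℝ ∞ φ w) : ContDiffAt ℝ ∞ (sndDeriv φ) w :=
  (hφ.fderiv_right (m := ∞) le_rfl).clm_comp contDiffAt_const

theorem contDiffAt_transDeriv (hφ : ContDiffAt ℝ ∞ φ w) (hψ : ContDiffAt ℝ ∞ ψ w)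
    (hi : (sndDeriv φ w).IsInvertible) (l : List (Fin p)) :
    ContDiffAt ℝ ∞ (transDeriv φ ψ l) w := by
  induction l with
  | nil => exact hψ
  | cons j l ih =>
    have h1 : ContDiffAt ℝ ∞ (fun w => (sndDeriv φ w).inverse) w :=
      hi.contDiffAt_map_inverse.comp w (contDiffAt_sndDeriv hφ)
    exact (ih.fderiv_right (m := ∞) le_rfl).clm_apply
      (contDiffAt_const.prodMk (h1.clm_apply contDiffAt_const))

/-- The recursion for `U_J` cleared of the inverse matrix: `∂_h U_J = ∑ᵢ (∂_h φⁱ) U_{i,J}`. In this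
form it can be differentiated in the parameter without differentiating an inverse. -/
theorem fderiv_transDeriv_snd (hi : (sndDeriv φ w).IsInvertible) (l : List (Fin p))
    (h : Fin p → ℝ) :
    fderiv ℝ (transDeriv φ ψ l) w (0, h) =
      ∑ i, sndDeriv φ w h i * transDeriv φ ψ (i :: l) w := by
  have h1 : h = ∑ i, sndDeriv φ w h i • (sndDeriv φ w).inverse (Pi.single i 1) := by
    obtain ⟨e, he⟩ := hi
    simp_rw [← map_smul, ← map_sum, ← he]
    rw [ContinuousLinearMap.inverse_equiv]
    have : ∑ i, (e : (Fin p → ℝ) →L[ℝ] (Fin p → ℝ)) h i • (Pi.single i 1 : Fin p → ℝ) = e h := by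
      simpa using (pi_eq_sum_univ' (e h)).symm
    rw [this]
    simp
  have h2 : ((0, h) : P × (Fin p → ℝ)) = ∑ i, sndDeriv φ w h i •
      ((0, (sndDeriv φ w).inverse (Pi.single i 1)) : P × (Fin p → ℝ)) := by
    refine Prod.ext ?_ ?_
    · simp [Prod.fst_sum]
    · simpa only [Prod.snd_sum, Prod.smul_snd] using h1
  rw [h2, map_sum]
  simp_rw [map_smul, smul_eq_mul]
  rfl

theorem eventually_isInvertible_sndDeriv (hφ : ContDiffAt ℝ ∞ φ w)
    (hi : (sndDeriv φ w).IsInvertible) : ∀ᶠ w' in 𝓝 w, (sndDeriv φ w').IsInvertible := by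
  obtain ⟨e, he⟩ := hi
  refine (contDiffAt_sndDeriv hφ).continuousAt.eventually ?_
  rw [← he]
  exact e.nhds

theorem hasFDerivAt_snd_of_differentiableAt {V : Type*} [NormedAddCommGroup V] [NormedSpace ℝ V]
    {F : P × (Fin p → ℝ) → V} {a : P} {x : Fin p → ℝ} (hF : DifferentiableAt ℝ F (a, x)) :
    HasFDerivAt (fun y => F (a, y))
      ((fderiv ℝ F (a, x)).comp (ContinuousLinearMap.inr ℝ P (Fin p → ℝ))) x :=
  hF.hasFDerivAt.comp x (hasFDerivAt_prodMk_right a x)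

/-- Differentiate the identity for `l` along `(∂φ/∂x)⁻¹ e_j`, which `∂φ/∂x` sends to `e_j`. The
identity must hold on a neighbourhood for the induction to differentiate it. -/
theorem partialDeriv_transform {f' : (Fin p → ℝ) → ℝ} {a : P} {x₀ : Fin p → ℝ}
    (hφ : ∀ᶠ x in 𝓝 x₀, ContDiffAt ℝ ∞ φ (a, x)) (hψ : ∀ᶠ x in 𝓝 x₀, ContDiffAt ℝ ∞ ψ (a, x))
    (hi : ∀ᶠ x in 𝓝 x₀, (sndDeriv φ (a, x)).IsInvertible)
    (hf : ∀ᶠ x in 𝓝 x₀, ContDiffAt ℝ ∞ f' (φ (a, x)))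
    (h : ∀ᶠ x in 𝓝 x₀, f' (φ (a, x)) = ψ (a, x)) (l : List (Fin p)) :
    ∀ᶠ x in 𝓝 x₀, partialDeriv l f' (φ (a, x)) = transDeriv φ ψ l (a, x) := by
  induction l with
  | nil => exact h
  | cons j l ih =>
    filter_upwards [hφ, hψ, hi, hf, ih.eventually_nhds] with x hφ hψ hi hf ih
    have h1 := hasFDerivAt_snd_of_differentiableAt
      ((contDiffAt_transDeriv hφ hψ hi l).differentiableAt (by simp))
    have h2 := hasFDerivAt_snd_of_differentiableAt (hφ.differentiableAt (by simp))
    have h3 : HasFDerivAt (fun y => partialDeriv l f' (φ (a, y))) _ x :=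
      ((contDiffAt_partialDeriv hf l).differentiableAt (by simp)).hasFDerivAt.comp x h2
    have h4 := congrArg (fun L => L ((sndDeriv φ (a, x)).inverse (Pi.single j 1)))
      (h3.unique (h1.congr_of_eventuallyEq ih))
    have h5 : sndDeriv φ (a, x) ((sndDeriv φ (a, x)).inverse (Pi.single j 1)) =
        Pi.single j 1 := by
      obtain ⟨e, he⟩ := hi
      rw [← he, ContinuousLinearMap.inverse_equiv]
      simp
    change fderiv ℝ (partialDeriv l f') (φ (a, x))
      (sndDeriv φ (a, x) ((sndDeriv φ (a, x)).inverse (Pi.single j 1))) = _ at h4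
    rw [h5] at h4
    exact h4

/-- Symmetry of second derivatives, with the right side involving only the slice at the fixed
parameter `a`. An identity known for that `a` alone, but for all `y`, can therefore be used. -/
theorem fderiv_fderiv_mixed {V : Type*} [NormedAddCommGroup V] [NormedSpace ℝ V]
    {F : P × (Fin p → ℝ) → V} {a : P} {x : Fin p → ℝ} (hF : ContDiffAt ℝ ∞ F (a, x)) (v : P)
    (h : Fin p → ℝ) :
    fderiv ℝ (fun w => fderiv ℝ F w (0, h)) (a, x) (v, 0) =
      fderiv ℝ (fun y => fderiv ℝ F (a, y) (v, 0)) x h := by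
  have hd : DifferentiableAt ℝ (fderiv ℝ F) (a, x) :=
    (hF.fderiv_right (m := ∞) le_rfl).differentiableAt (by simp)
  have hs := hF.isSymmSndFDerivAt (by simpa using WithTop.coe_le_coe.2 (le_top : (2 : ℕ∞) ≤ ⊤))
  have h1 := hasFDerivAt_snd_of_differentiableAt
    (F := fun w => fderiv ℝ F w (v, 0)) (hd.clm_apply (differentiableAt_const _))
  rw [h1.fderiv, fderiv_clm_apply hd (differentiableAt_const _)]
  simp only [ContinuousLinearMap.comp_apply]
  rw [fderiv_clm_apply hd (differentiableAt_const _)]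
  simpa using hs _ _

theorem sndDeriv_of_eq_id {a₀ : P} (hφ : ∀ x, ContDiffAt ℝ ∞ φ (a₀, x))
    (hφ₀ : ∀ x, φ (a₀, x) = x) (x : Fin p → ℝ) :
    sndDeriv φ (a₀, x) = ContinuousLinearMap.id ℝ _ := by
  have h1 := hasFDerivAt_snd_of_differentiableAt ((hφ x).differentiableAt (by simp))
  simp_rw [hφ₀] at h1
  exact h1.unique (hasFDerivAt_id x)

/-- The first variation of the derivatives of the transforms of `f`. -/
theorem fderiv_transDeriv_fst {f : (Fin p → ℝ) → ℝ} (hf : ContDiff ℝ ∞ f) {a₀ : P}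
    (hφ : ∀ x, ContDiffAt ℝ ∞ φ (a₀, x)) (hψ : ∀ x, ContDiffAt ℝ ∞ ψ (a₀, x))
    (hφ₀ : ∀ x, φ (a₀, x) = x) (hψ₀ : ∀ x, ψ (a₀, x) = f x) (v : P)
    {ξ : Fin p → (Fin p → ℝ) → ℝ} (hξ : ∀ i, ContDiff ℝ ∞ (ξ i))
    {η : (Fin p → ℝ) → ℝ} (hη : ContDiff ℝ ∞ η)
    (hφξ : ∀ x i, fderiv ℝ φ (a₀, x) (v, 0) i = ξ i x)
    (hψη : ∀ x, fderiv ℝ ψ (a₀, x) (v, 0) = η x) (l : List (Fin p)) (x : Fin p → ℝ) :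
    fderiv ℝ (transDeriv φ ψ l) (a₀, x) (v, 0) =
      multiDeriv (l : Multiset (Fin p))
        (fun y => η y - ∑ i, fderiv ℝ f y (Pi.single i 1) * ξ i y) x +
      ∑ i, multiDeriv (i ::ₘ (l : Multiset (Fin p))) f x * ξ i x := by
  have hid := sndDeriv_of_eq_id hφ hφ₀
  have hinv : ∀ x, (sndDeriv φ (a₀, x)).IsInvertible := fun x => by
    rw [hid]; exact ⟨ContinuousLinearEquiv.refl ℝ _, rfl⟩
  have hU := fun l x => contDiffAt_transDeriv (hφ x) (hψ x) (hinv x) l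
  have hUd := fun l x => (hU l x).differentiableAt (by simp)
  have hd : ∀ i, ContDiff ℝ ∞ fun y => fderiv ℝ f y (Pi.single i 1) :=
    fun i => (hf.fderiv_right (m := ∞) le_rfl).clm_apply contDiff_const
  have hQ : ContDiff ℝ ∞ fun y => η y - ∑ i, fderiv ℝ f y (Pi.single i 1) * ξ i y :=
    hη.sub (ContDiff.sum fun i _ => (hd i).mul (hξ i))
  -- At the identity, `f` is its own transform.
  have hU₀ : ∀ l x, transDeriv φ ψ l (a₀, x) = multiDeriv (l : Multiset (Fin p)) f x := by
    intro l x
    rw [← partialDeriv_eq_multiDeriv hf, ← (partialDeriv_transform (f' := f) (.of_forall hφ)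
      (.of_forall hψ) (.of_forall hinv) (.of_forall fun _ => hf.contDiffAt)
      (.of_forall fun y => by rw [hφ₀, hψ₀]) l).self_of_nhds, hφ₀]
  induction l generalizing x with
  | nil =>
    change fderiv ℝ ψ _ _ = _
    rw [hψη]
    simp only [Multiset.coe_nil, multiDeriv_zero, multiDeriv_cons hf]
    ring
  | cons j l ih =>
    have hφd : DifferentiableAt ℝ (fun w => sndDeriv φ w (Pi.single j 1)) (a₀, x) :=
      ((contDiffAt_sndDeriv (hφ x)).clm_apply contDiffAt_const).differentiableAt
        (n := ∞) (by simp)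
    have hφdi : ∀ i, HasFDerivAt (fun w => sndDeriv φ w (Pi.single j 1) i)
        ((ContinuousLinearMap.proj (R := ℝ) (φ := fun _ : Fin p => ℝ) i).comp
          (fderiv ℝ (fun w => sndDeriv φ w (Pi.single j 1)) (a₀, x))) (a₀, x) := fun i =>
      hasFDerivAt_pi'.1 hφd.hasFDerivAt i
    -- First evaluation of the mixed derivative of `U_l`: exchange the order and differentiate the
    -- induction hypothesis in `x`.
    have hleft : fderiv ℝ (fun w => fderiv ℝ (transDeriv φ ψ l) w (0, Pi.single j 1))
        (a₀, x) (v, 0) = multiDeriv (j ::ₘ (l : Multiset (Fin p)))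
          (fun y => η y - ∑ i, fderiv ℝ f y (Pi.single i 1) * ξ i y) x +
        ∑ i, (multiDeriv (i ::ₘ j ::ₘ (l : Multiset (Fin p))) f x * ξ i x +
          multiDeriv (i ::ₘ (l : Multiset (Fin p))) f x * fderiv ℝ (ξ i) x (Pi.single j 1)) := by
      rw [fderiv_fderiv_mixed (hU l x), funext ih, fderiv_fun_add
        (differentiable_multiDeriv hQ _ x)
        (DifferentiableAt.fun_sum fun i _ => (differentiable_multiDeriv hf _ x).fun_mul
          ((hξ i).differentiable (by simp) x)),
        fderiv_fun_sum fun i _ => (differentiable_multiDeriv hf _ x).fun_mul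
          ((hξ i).differentiable (by simp) x), _root_.add_apply,
        ← multiDeriv_cons hQ, _root_.sum_apply]
      congr 1
      refine Finset.sum_congr rfl fun i _ => ?_
      rw [fderiv_fun_mul (differentiable_multiDeriv hf _ x)
        ((hξ i).differentiable (by simp) x), Multiset.cons_swap, multiDeriv_cons hf j]
      simp
      ring
    -- Second evaluation: differentiate the recursion of `fderiv_transDeriv_snd`, valid near `(a₀,
    -- x)`, by the product rule.
    have hright : HasFDerivAt (fun w => fderiv ℝ (transDeriv φ ψ l) w (0, Pi.single j 1)) _
        (a₀, x) :=
      (HasFDerivAt.fun_sum fun i (_ : i ∈ Finset.univ) =>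
        (hφdi i).mul (hUd (i :: l) x).hasFDerivAt).congr_of_eventuallyEq <| by
      filter_upwards [eventually_isInvertible_sndDeriv (hφ x) (hinv x)] with w hw
      exact fderiv_transDeriv_snd hw l _
    have hmix : ∀ i, fderiv ℝ (fun w => sndDeriv φ w (Pi.single j 1)) (a₀, x) (v, 0) i =
        fderiv ℝ (ξ i) x (Pi.single j 1) := by
      intro i
      have h1 : (fun y => fderiv ℝ φ (a₀, y) (v, 0)) = fun y i => ξ i y :=
        funext fun y => funext fun i => hφξ y i
      have h2 := fderiv_fderiv_mixed (hφ x) v (Pi.single j 1)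
      rw [h1, fderiv_pi fun i => (hξ i).differentiable (by simp) x] at h2
      exact congrFun h2 i
    rw [hright.fderiv, _root_.sum_apply] at hleft
    simp only [_root_.add_apply, _root_.smul_apply, ContinuousLinearMap.comp_apply,
      ContinuousLinearMap.proj_apply, hmix, hid, hU₀, smul_eq_mul,
      ContinuousLinearMap.id_apply, Finset.sum_add_distrib] at hleft
    -- As `∂φ/∂x` is the identity at `a₀`, only `i = j` keeps the derivative of `U_{i,l}`. The terms
    -- with `∂_j ξⁱ` occur in both evaluations and cancel.
    rw [Finset.sum_eq_single j (by intro i _ hij; simp [Pi.single_eq_of_ne hij]) (by simp)]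
      at hleft
    simp only [Pi.single_eq_same, one_mul, ← Multiset.cons_coe] at hleft ⊢
    linarith

end TransDeriv

/-! ### One-parameter subgroups and the action in a chart at the identity -/

section OneParameter

variable {E : Type*} [NormedAddCommGroup E] [NormedSpace ℝ E] [FiniteDimensional ℝ E]
  {G : Type*} [TopologicalSpace G] [ChartedSpace E G] [Group G] [LieGroup 𝓘(ℝ, E) ∞ G]
  [T2Space G]

/-- `lieExp` chooses a separate curve for every vector. Rescaling time in the curve of `v` gives one
for `ε • v`, and uniqueness of integral curves identifies them. -/
theorem exists_integralCurve_lieExp (v : GroupLieAlgebra 𝓘(ℝ, E) G) :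
    ∃ γ : ℝ → G, γ 0 = 1 ∧ IsMIntegralCurve (I := 𝓘(ℝ, E)) γ (mulInvariantVectorField v) ∧
      ∀ ε : ℝ, lieExp (ε • v) = γ ε := by
  have h3 : LieGroup 𝓘(ℝ, E) (minSmoothness ℝ 3) G := by
    rw [minSmoothness_of_isRCLikeNormedField]
    exact LieGroup.of_le (n := ∞) (WithTop.coe_le_coe.2 (le_top : (3 : ℕ∞) ≤ ⊤))
  have : IsManifold 𝓘(ℝ, E) 1 G :=
    IsManifold.of_le (n := ∞) (by exact_mod_cast (le_top : (1 : ℕ∞) ≤ ⊤))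
  have : CompleteSpace E := FiniteDimensional.complete ℝ E
  have hv : ∀ v : GroupLieAlgebra 𝓘(ℝ, E) G, ContMDiff 𝓘(ℝ, E) 𝓘(ℝ, E).tangent 1
      (fun g : G => (mulInvariantVectorField v g : TangentBundle 𝓘(ℝ, E) G)) := fun v => by
    refine (contMDiff_mulInvariantVectorField v).of_le ?_
    rw [minSmoothness_of_isRCLikeNormedField]
    exact one_le_two
  obtain ⟨γ, h0, hγ⟩ := exists_integralCurve v
  refine ⟨γ, h0, hγ, fun ε => ?_⟩
  obtain ⟨h0', hγ'⟩ := Classical.choose_spec (exists_integralCurve (ε • v))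
  have h1 : IsMIntegralCurve (I := 𝓘(ℝ, E)) (γ ∘ (· * ε)) (mulInvariantVectorField (ε • v)) := by
    convert hγ.comp_mul ε using 1
    funext g
    exact map_smul (mfderiv 𝓘(ℝ, E) 𝓘(ℝ, E) (fun b : G => g * b) 1) ε v
  have h2 := isMIntegralCurve_Ioo_eq_of_contMDiff_boundaryless (t₀ := 0) (hv _) hγ' h1
    (by rw [h0']; simp [h0])
  change Classical.choose (exists_integralCurve (ε • v)) 1 = _
  rw [h2]
  simp

/-- All that is needed of the exponential map: near `0` it is a curve in `E` with a velocity `c'`.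
-/
theorem exists_chart_curve (v : GroupLieAlgebra 𝓘(ℝ, E) G) :
    ∃ (c : ℝ → E) (c' : E), c 0 = extChartAt 𝓘(ℝ, E) (1 : G) 1 ∧ HasDerivAt c c' 0 ∧
      ∀ᶠ ε : ℝ in 𝓝 0, (extChartAt 𝓘(ℝ, E) (1 : G)).symm (c ε) = lieExp (ε • v) := by
  have : IsManifold 𝓘(ℝ, E) 1 G :=
    IsManifold.of_le (n := ∞) (by exact_mod_cast (le_top : (1 : ℕ∞) ≤ ⊤))
  obtain ⟨γ, h0, hγ, hexp⟩ := exists_integralCurve_lieExp v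
  have hc : ContinuousAt γ 0 := (hγ 0).continuousAt
  have h1 : MDifferentiableAt 𝓘(ℝ, ℝ) 𝓘(ℝ, E) (fun ε => extChartAt 𝓘(ℝ, E) (1 : G) (γ ε)) 0 := by
    have h2 : MDifferentiableAt 𝓘(ℝ, E) 𝓘(ℝ, E) (extChartAt 𝓘(ℝ, E) (1 : G)) (γ 0) := by
      rw [h0]
      exact mdifferentiableAt_extChartAt (mem_chart_source E (1 : G))
    exact h2.comp (0 : ℝ) (hγ 0).mdifferentiableAt
  refine ⟨fun ε => extChartAt 𝓘(ℝ, E) (1 : G) (γ ε), _, by simp only [h0],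
    h1.differentiableAt.hasDerivAt, ?_⟩
  have h3 : ∀ᶠ ε in 𝓝 (0 : ℝ), γ ε ∈ (extChartAt 𝓘(ℝ, E) (1 : G)).source :=
    hc.eventually (by rw [h0]; exact extChartAt_source_mem_nhds (I := 𝓘(ℝ, E)) (1 : G))
  filter_upwards [h3] with ε hε
  rw [hexp, (extChartAt 𝓘(ℝ, E) (1 : G)).left_inv hε]

end OneParameter

namespace LieGroupAction

section LocalAct

variable {E G M : Type*} [NormedAddCommGroup E] [NormedSpace ℝ E]
  [TopologicalSpace G] [ChartedSpace E G] [Group G] [NormedAddCommGroup M] [NormedSpace ℝ M]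

/-- The action read in the preferred chart at the identity. -/
def localAct (A : LieGroupAction E G M) (w : E × M) : M :=
  A.act ((extChartAt 𝓘(ℝ, E) (1 : G)).symm w.1) w.2

theorem localAct_one (A : LieGroupAction E G M) (y : M) :
    A.localAct (extChartAt 𝓘(ℝ, E) (1 : G) 1, y) = y := by
  rw [localAct, extChartAt_to_inv, A.one_act]

theorem eventually_localAct [IsManifold 𝓘(ℝ, E) ∞ G] (A : LieGroupAction E G M) (y : M) :
    ∀ᶠ w in 𝓝 (extChartAt 𝓘(ℝ, E) (1 : G) 1, y),
      ((extChartAt 𝓘(ℝ, E) (1 : G)).symm w.1, w.2) ∈ A.domain ∧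
        ContDiffAt ℝ ∞ A.localAct w := by
  have h1 : ∀ᶠ w : E × M in 𝓝 (extChartAt 𝓘(ℝ, E) (1 : G) 1, y),
      w.1 ∈ (extChartAt 𝓘(ℝ, E) (1 : G)).target :=
    continuousAt_fst.eventually
      ((isOpen_extChartAt_target (I := 𝓘(ℝ, E)) (1 : G)).mem_nhds (mem_extChartAt_target 1))
  have h2 : ∀ᶠ w : E × M in 𝓝 (extChartAt 𝓘(ℝ, E) (1 : G) 1, y),
      ((extChartAt 𝓘(ℝ, E) (1 : G)).symm w.1, w.2) ∈ A.domain := by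
    have hc : ContinuousAt (fun w : E × M => ((extChartAt 𝓘(ℝ, E) (1 : G)).symm w.1, w.2))
        (extChartAt 𝓘(ℝ, E) (1 : G) 1, y) :=
      (ContinuousAt.comp (f := Prod.fst) (continuousAt_extChartAt_symm (I := 𝓘(ℝ, E)) (1 : G))
        continuousAt_fst).prodMk continuousAt_snd
    refine hc.eventually (A.isOpen_domain.mem_nhds ?_)
    simpa only [extChartAt_to_inv] using A.one_mem y
  filter_upwards [h1, h2] with w hw1 hw2
  refine ⟨hw2, ?_⟩
  rw [← contMDiffAt_iff_contDiffAt]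
  have h3 : ContMDiffAt (𝓘(ℝ, E).prod 𝓘(ℝ, M)) 𝓘(ℝ, M) ∞
      (fun z : G × M => A.act z.1 z.2) ((extChartAt 𝓘(ℝ, E) (1 : G)).symm w.1, w.2) :=
    (A.smooth _ hw2).contMDiffAt (A.isOpen_domain.mem_nhds hw2)
  have h4 : ContMDiffAt 𝓘(ℝ, E) 𝓘(ℝ, E) ∞ (extChartAt 𝓘(ℝ, E) (1 : G)).symm w.1 :=
    (contMDiffOn_extChartAt_symm (1 : G) _ hw1).contMDiffAt
      ((isOpen_extChartAt_target (I := 𝓘(ℝ, E)) (1 : G)).mem_nhds hw1)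
  have h5 : ContMDiffAt 𝓘(ℝ, E × M) (𝓘(ℝ, E).prod 𝓘(ℝ, M)) ∞
      (fun w : E × M => ((extChartAt 𝓘(ℝ, E) (1 : G)).symm w.1, w.2)) w :=
    (h4.comp w contDiffAt_fst.contMDiffAt).prodMk contDiffAt_snd.contMDiffAt
  exact h3.comp (x := w) h5

theorem contDiffAt_localAct_one [IsManifold 𝓘(ℝ, E) ∞ G] (A : LieGroupAction E G M) (y : M) :
    ContDiffAt ℝ ∞ A.localAct (extChartAt 𝓘(ℝ, E) (1 : G) 1, y) :=
  (A.eventually_localAct y).self_of_nhds.2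

theorem infinitesimal_eq [FiniteDimensional ℝ E] [LieGroup 𝓘(ℝ, E) ∞ G] [T2Space G]
    (A : LieGroupAction E G M)
    {v : GroupLieAlgebra 𝓘(ℝ, E) G} {c : ℝ → E} {c' : E}
    (hc0 : c 0 = extChartAt 𝓘(ℝ, E) (1 : G) 1) (hc : HasDerivAt c c' 0)
    (hexp : ∀ᶠ ε : ℝ in 𝓝 0, (extChartAt 𝓘(ℝ, E) (1 : G)).symm (c ε) = lieExp (ε • v)) (y : M) :
    A.infinitesimal v y =
      fderiv ℝ A.localAct (extChartAt 𝓘(ℝ, E) (1 : G) 1, y) (c', 0) := by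
  have h1 : HasDerivAt (fun ε => A.localAct (c ε, y))
      (fderiv ℝ A.localAct (extChartAt 𝓘(ℝ, E) (1 : G) 1, y) (c', 0)) 0 := by
    have h2 : HasFDerivAt A.localAct
        (fderiv ℝ A.localAct (extChartAt 𝓘(ℝ, E) (1 : G) 1, y)) (c 0, y) := by
      rw [hc0]
      exact ((A.contDiffAt_localAct_one y).differentiableAt (by simp)).hasFDerivAt
    exact h2.comp_hasDerivAt (0 : ℝ) (hc.prodMk (hasDerivAt_const (0 : ℝ) y))
  refine (h1.congr_of_eventuallyEq ?_).deriv
  filter_upwards [hexp] with ε hε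
  rw [localAct, hε]

end LocalAct

/-! ### Existence of the prolongation -/

section Existence

variable {E G : Type*} [NormedAddCommGroup E] [NormedSpace ℝ E]
  [TopologicalSpace G] [ChartedSpace E G] [Group G] {p q : ℕ}

theorem contDiffAt_act_graph (A : LieGroupAction E G (Total p q)) {g : G}
    {f : (Fin p → ℝ) → Fin q → ℝ} (hf : ContDiff ℝ ∞ f) {x : Fin p → ℝ}
    (h : (g, (x, f x)) ∈ A.domain) : ContDiffAt ℝ ∞ (fun x => A.act g (x, f x)) x :=
  (A.contDiffAt_act h).comp x (contDiffAt_id.prodMk hf.contDiffAt)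

/-- The inverse function theorem for the `X`-component `φ` of the action on the graph; the transform
is `ψ ∘ φ⁻¹`. -/
theorem exists_transform (A : LieGroupAction E G (Total p q)) {g : G}
    {f : (Fin p → ℝ) → Fin q → ℝ} (hf : ContDiff ℝ ∞ f) {x₀ : Fin p → ℝ}
    (hd : (g, (x₀, f x₀)) ∈ A.domain)
    (hi : (fderiv ℝ (fun x => (A.act g (x, f x)).1) x₀).IsInvertible) :
    ∃ f' : (Fin p → ℝ) → Fin q → ℝ,
      (∀ᶠ x in 𝓝 (A.act g (x₀, f x₀)).1, ContDiffAt ℝ ∞ f' x) ∧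
      (∀ᶠ y in 𝓝 (A.act g (x₀, f x₀)), y ∈ A.image g {w | w.2 = f w.1} ↔ y.2 = f' y.1) ∧
      ∀ᶠ x in 𝓝 x₀, f' (A.act g (x, f x)).1 = (A.act g (x, f x)).2 := by
  obtain ⟨e, he⟩ := hi
  set φ : (Fin p → ℝ) → Fin p → ℝ := fun x => (A.act g (x, f x)).1 with hφdef
  have hgraph : Continuous fun x => (x, f x) := continuous_id.prodMk hf.continuous
  have hdom : ∀ᶠ x in 𝓝 x₀, (g, (x, f x)) ∈ A.domain :=
    hgraph.continuousAt.eventually (A.eventually_mem_domain hd)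
  have hφ : ∀ x, (g, (x, f x)) ∈ A.domain → ContDiffAt ℝ ∞ φ x := fun x hx =>
    (A.contDiffAt_act_graph hf hx).fst
  have hφ₀ := hφ x₀ hd
  have hφ' : HasFDerivAt φ (e : (Fin p → ℝ) →L[ℝ] (Fin p → ℝ)) x₀ := by
    rw [he]; exact (hφ₀.differentiableAt (by simp)).hasFDerivAt
  let R := hφ₀.toOpenPartialHomeomorph φ hφ' (by simp)
  have hR : ∀ x, R x = φ x := fun x => rfl
  have hx₀ : x₀ ∈ R.source := hφ₀.mem_toOpenPartialHomeomorph_source hφ' (by simp)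
  have hy₀ : φ x₀ ∈ R.target := hφ₀.image_mem_toOpenPartialHomeomorph_target hφ' (by simp)
  have hsymm₀ : R.symm (φ x₀) = x₀ := R.left_inv hx₀
  have hsymmc : Filter.Tendsto R.symm (𝓝 (φ x₀)) (𝓝 x₀) := by
    have := R.continuousAt_symm hy₀
    rwa [ContinuousAt, hsymm₀] at this
  -- Invertibility persists nearby, so that the local inverse is smooth on a neighbourhood and not
  -- just at one point.
  have hinv : ∀ᶠ x in 𝓝 x₀, (fderiv ℝ φ x).IsInvertible := by
    refine (hφ₀.fderiv_right (m := ∞) le_rfl).continuousAt.eventually ?_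
    rw [← he]
    exact e.nhds
  have htarget : ∀ᶠ y in 𝓝 (φ x₀), y ∈ R.target := R.open_target.mem_nhds hy₀
  refine ⟨fun y => (A.act g (R.symm y, f (R.symm y))).2, ?_, ?_, ?_⟩
  · filter_upwards [htarget, hsymmc.eventually hdom, hsymmc.eventually hinv] with y hy hyd hyi
    obtain ⟨e', he'⟩ := hyi
    have h1 : ContDiffAt ℝ ∞ R.symm y := by
      refine R.contDiffAt_symm hy (f₀' := e') ?_ (hφ _ hyd)
      rw [he']
      exact ((hφ _ hyd).differentiableAt (by simp)).hasFDerivAt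
    exact ((A.contDiffAt_act_graph hf hyd).comp y h1).snd
  · have hback : Filter.Tendsto (fun y => (A.act g⁻¹ y).1) (𝓝 (A.act g (x₀, f x₀))) (𝓝 x₀) := by
      have h1 := (A.contDiffAt_act (A.inv_mem g _ hd)).continuousAt.fst
      rwa [ContinuousAt, A.inv_act g _ hd] at h1
    filter_upwards [hback.eventually (R.open_source.mem_nhds hx₀),
      continuousAt_fst.eventually htarget,
      (hsymmc.comp continuousAt_fst).eventually hdom] with y hy1 hy2 hy3
    constructor
    · rintro ⟨w, hw, hwd, rfl⟩
      obtain ⟨x, u⟩ := w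
      obtain rfl : u = f x := hw
      rw [A.inv_act g _ hwd] at hy1
      have : R.symm (A.act g (x, f x)).1 = x := R.left_inv hy1
      simp only [this]
    · intro hy
      refine ⟨(R.symm y.1, f (R.symm y.1)), rfl, hy3, ?_⟩
      exact Prod.ext (R.right_inv hy2) hy.symm
  · filter_upwards [R.open_source.mem_nhds hx₀] with x hx
    have : R.symm (A.act g (x, f x)).1 = x := R.left_inv hx
    simp only [this]

end Existence

/-! ### The prolonged infinitesimal action -/

section Prolong

variable {E G : Type*} [NormedAddCommGroup E] [NormedSpace ℝ E]
  [TopologicalSpace G] [ChartedSpace E G] [Group G] {p q : ℕ}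

/-- The `x`-component of the action on the graph of `f`, in the chart at the identity. -/
def graphFst (A : LieGroupAction E G (Total p q)) (f : (Fin p → ℝ) → Fin q → ℝ)
    (w : E × (Fin p → ℝ)) : Fin p → ℝ :=
  (A.localAct (w.1, (w.2, f w.2))).1

/-- The `u^α`-component of the action on the graph of `f`, in the chart at the identity. -/
def graphSnd (A : LieGroupAction E G (Total p q)) (f : (Fin p → ℝ) → Fin q → ℝ) (α : Fin q)
    (w : E × (Fin p → ℝ)) : ℝ :=
  (A.localAct (w.1, (w.2, f w.2))).2 α

/-- The prolonged action on the `n`-jet of `f` at `x₀`, in the chart at the identity. -/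
def localProlong (A : LieGroupAction E G (Total p q)) (n : ℕ) (f : (Fin p → ℝ) → Fin q → ℝ)
    (x₀ : Fin p → ℝ) (a : E) : Jet p q n :=
  (A.graphFst f (a, x₀), fun J α =>
    transDeriv (A.graphFst f) (A.graphSnd f α) (J.1.sort (· ≤ ·)) (a, x₀))

variable {A : LieGroupAction E G (Total p q)} {f : (Fin p → ℝ) → Fin q → ℝ}

theorem contDiffAt_localAct_graph (hf : ContDiff ℝ ∞ f) {w : E × (Fin p → ℝ)}
    (h : ContDiffAt ℝ ∞ A.localAct (w.1, (w.2, f w.2))) :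
    ContDiffAt ℝ ∞ (fun w : E × (Fin p → ℝ) => A.localAct (w.1, (w.2, f w.2))) w :=
  ContDiffAt.comp (g := A.localAct) (f := fun w : E × (Fin p → ℝ) => (w.1, (w.2, f w.2))) w h
    (contDiffAt_fst.prodMk (contDiffAt_snd.prodMk (hf.contDiffAt.comp w contDiffAt_snd)))

theorem contDiffAt_graphFst (hf : ContDiff ℝ ∞ f) {w : E × (Fin p → ℝ)}
    (h : ContDiffAt ℝ ∞ A.localAct (w.1, (w.2, f w.2))) : ContDiffAt ℝ ∞ (A.graphFst f) w :=
  (contDiffAt_localAct_graph hf h).fst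

theorem contDiffAt_graphSnd (hf : ContDiff ℝ ∞ f) {w : E × (Fin p → ℝ)}
    (h : ContDiffAt ℝ ∞ A.localAct (w.1, (w.2, f w.2))) (α : Fin q) :
    ContDiffAt ℝ ∞ (A.graphSnd f α) w :=
  contDiffAt_pi.1 (contDiffAt_localAct_graph hf h).snd α

theorem fderiv_localAct_graph (hf : ContDiff ℝ ∞ f) {w : E × (Fin p → ℝ)}
    (h : ContDiffAt ℝ ∞ A.localAct (w.1, (w.2, f w.2))) (c : E) :
    fderiv ℝ (fun w : E × (Fin p → ℝ) => A.localAct (w.1, (w.2, f w.2))) w (c, 0) =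
      fderiv ℝ A.localAct (w.1, (w.2, f w.2)) (c, 0) := by
  have h1 : HasFDerivAt (fun w : E × (Fin p → ℝ) => (w.1, (w.2, f w.2)))
      ((ContinuousLinearMap.fst ℝ E (Fin p → ℝ)).prod ((ContinuousLinearMap.snd ℝ E _).prod
        ((fderiv ℝ f w.2).comp (ContinuousLinearMap.snd ℝ E (Fin p → ℝ))))) w :=
    hasFDerivAt_fst.prodMk (hasFDerivAt_snd.prodMk
      (((hf.differentiable (by simp) _).hasFDerivAt).comp w hasFDerivAt_snd))
  have h2 : HasFDerivAt (fun w : E × (Fin p → ℝ) => A.localAct (w.1, (w.2, f w.2))) _ w :=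
    HasFDerivAt.comp (g := A.localAct) (f := fun w : E × (Fin p → ℝ) => (w.1, (w.2, f w.2))) w
      (h.differentiableAt (by simp)).hasFDerivAt h1
  rw [h2.fderiv]
  simp [Prod.zero_eq_mk]

theorem fderiv_graphFst (hf : ContDiff ℝ ∞ f) {w : E × (Fin p → ℝ)}
    (h : ContDiffAt ℝ ∞ A.localAct (w.1, (w.2, f w.2))) (c : E) :
    fderiv ℝ (A.graphFst f) w (c, 0) = (fderiv ℝ A.localAct (w.1, (w.2, f w.2)) (c, 0)).1 := by
  have hd := (contDiffAt_localAct_graph hf h).differentiableAt (by simp)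
  rw [← fderiv_localAct_graph hf h]
  exact congrArg (fun L => L (c, 0)) hd.hasFDerivAt.fst.fderiv

theorem fderiv_graphSnd (hf : ContDiff ℝ ∞ f) {w : E × (Fin p → ℝ)}
    (h : ContDiffAt ℝ ∞ A.localAct (w.1, (w.2, f w.2))) (c : E) (α : Fin q) :
    fderiv ℝ (A.graphSnd f α) w (c, 0) =
      (fderiv ℝ A.localAct (w.1, (w.2, f w.2)) (c, 0)).2 α := by
  have hd := (contDiffAt_localAct_graph hf h).differentiableAt (by simp)
  rw [← fderiv_localAct_graph hf h]
  exact congrArg (fun L => L (c, 0)) (hasFDerivAt_pi'.1 hd.hasFDerivAt.snd α).fderiv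

theorem graphFst_one (x : Fin p → ℝ) :
    A.graphFst f (extChartAt 𝓘(ℝ, E) (1 : G) 1, x) = x := by
  rw [graphFst, localAct_one]

theorem graphSnd_one (α : Fin q) (x : Fin p → ℝ) :
    A.graphSnd f α (extChartAt 𝓘(ℝ, E) (1 : G) 1, x) = f x α := by
  rw [graphSnd, localAct_one]

theorem isInvertible_sndDeriv_one [IsManifold 𝓘(ℝ, E) ∞ G] (hf : ContDiff ℝ ∞ f)
    (x : Fin p → ℝ) :
    (sndDeriv (A.graphFst f) (extChartAt 𝓘(ℝ, E) (1 : G) 1, x)).IsInvertible := by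
  rw [sndDeriv_of_eq_id (fun x => contDiffAt_graphFst hf (A.contDiffAt_localAct_one _))
    graphFst_one]
  exact ⟨ContinuousLinearEquiv.refl ℝ _, rfl⟩

theorem eventually_isProlongation [IsManifold 𝓘(ℝ, E) ∞ G]
    (hf : ContDiff ℝ ∞ f) (n : ℕ) (x₀ : Fin p → ℝ) :
    ∀ᶠ a in 𝓝 (extChartAt 𝓘(ℝ, E) (1 : G) 1),
      A.IsProlongation n ((extChartAt 𝓘(ℝ, E) (1 : G)).symm a) (jet n f x₀)
        (A.localProlong n f x₀ a) := by
  have hc : Continuous fun w : E × (Fin p → ℝ) => (w.1, (w.2, f w.2)) :=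
    continuous_fst.prodMk (continuous_snd.prodMk (hf.continuous.comp continuous_snd))
  have h1 := (hc.continuousAt (x := (extChartAt 𝓘(ℝ, E) (1 : G) 1, x₀))).eventually
    (A.eventually_localAct _)
  have h2 := eventually_isInvertible_sndDeriv (contDiffAt_graphFst hf
    (A.contDiffAt_localAct_one _)) (isInvertible_sndDeriv_one (A := A) hf x₀)
  -- For each `a` near `a₀`, the conditions must hold for all `x` in a neighbourhood of `x₀`;
  -- `eventually_nhds` provides this.
  have h3 := (Continuous.prodMk_left x₀).continuousAt.eventually (h1.and h2).eventually_nhds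
  filter_upwards [h3] with a ha
  have hx := (Continuous.prodMk_right a).continuousAt.eventually ha
  obtain ⟨⟨hd₀, hs₀⟩, hi₀⟩ := hx.self_of_nhds
  have hi : (fderiv ℝ (fun x => (A.act ((extChartAt 𝓘(ℝ, E) (1 : G)).symm a) (x, f x)).1)
      x₀).IsInvertible := by
    have := (hasFDerivAt_snd_of_differentiableAt
      ((contDiffAt_graphFst hf hs₀).differentiableAt (by simp))).fderiv
    change fderiv ℝ (fun x => A.graphFst f (a, x)) x₀ = sndDeriv (A.graphFst f) (a, x₀) at this
    exact this ▸ hi₀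
  obtain ⟨f', hf', him, hcomp⟩ := A.exists_transform hf hd₀ hi
  have hbase : (jet n f x₀).base = (x₀, f x₀) := jet_base f x₀
  refine ⟨by rw [hbase]; exact hd₀, f, f', hf, rfl, by rw [hbase]; exact hf',
    by rw [hbase]; exact him, ?_⟩
  rw [hbase]
  have hcont : ContinuousAt (fun x => A.graphFst f (a, x)) x₀ :=
    (contDiffAt_graphFst hf hs₀).continuousAt.comp (Continuous.prodMk_right a).continuousAt
  refine Prod.ext rfl (funext fun J => funext fun α => ?_)
  refine (partialDeriv_transform (f' := fun y => f' y α) ?_ ?_ ?_ ?_ ?_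
    (J.1.sort (· ≤ ·))).self_of_nhds.symm
  · filter_upwards [hx] with x hx using contDiffAt_graphFst hf hx.1.2
  · filter_upwards [hx] with x hx using contDiffAt_graphSnd hf hx.1.2 α
  · filter_upwards [hx] with x hx using hx.2
  · filter_upwards [hcont.eventually hf'] with x hx using contDiffAt_pi.1 hx α
  · filter_upwards [hcomp] with x hx using congrFun hx α

theorem prolong_eq {n : ℕ} {g : G} {z z' : Jet p q n}
    (h : A.IsProlongation n g z z') : A.prolong n g z = z' :=
  isProlongation_unique (Classical.epsilon_spec ⟨z', h⟩) h

theorem hasFDerivAt_localProlong [IsManifold 𝓘(ℝ, E) ∞ G] (hf : ContDiff ℝ ∞ f) (n : ℕ)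
    (x₀ : Fin p → ℝ) : ∃ L : E →L[ℝ] Jet p q n,
      HasFDerivAt (A.localProlong n f x₀) L (extChartAt 𝓘(ℝ, E) (1 : G) 1) ∧
      ∀ c, L c = (fderiv ℝ (A.graphFst f) (extChartAt 𝓘(ℝ, E) (1 : G) 1, x₀) (c, 0),
        fun J α => fderiv ℝ (transDeriv (A.graphFst f) (A.graphSnd f α) (J.1.sort (· ≤ ·)))
          (extChartAt 𝓘(ℝ, E) (1 : G) 1, x₀) (c, 0)) := by
  have hs := A.contDiffAt_localAct_one (x₀, f x₀)
  have h1 := (contDiffAt_graphFst (w := (_, x₀)) hf hs).differentiableAt (by simp)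
  have h2 := fun (J : MultiIndex p n) (α : Fin q) =>
    (contDiffAt_transDeriv (contDiffAt_graphFst (w := (_, x₀)) hf hs)
      (contDiffAt_graphSnd (w := (_, x₀)) hf hs α)
      (isInvertible_sndDeriv_one hf x₀) (J.1.sort (· ≤ ·))).differentiableAt (by simp)
  have hl := hasFDerivAt_prodMk_left (𝕜 := ℝ) (extChartAt 𝓘(ℝ, E) (1 : G) 1) x₀
  have h1' := h1.hasFDerivAt.comp (extChartAt 𝓘(ℝ, E) (1 : G) 1) hl
  have h2' := fun J α => (h2 J α).hasFDerivAt.comp (extChartAt 𝓘(ℝ, E) (1 : G) 1) hl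
  exact ⟨_, h1'.prodMk <| hasFDerivAt_pi.2 fun J => hasFDerivAt_pi.2 fun α => h2' J α,
    fun c => rfl⟩

/-- Well-definedness and differentiability of the prolonged action, and its derivative. -/
theorem hasDerivAt_prolong [FiniteDimensional ℝ E] [LieGroup 𝓘(ℝ, E) ∞ G] [T2Space G] {r : ℕ}
    {Θ : Total p q → Fin r → ℝ} (hΘ : ContDiff ℝ ∞ Θ) (A : LieGroupAction E G (Total p q))
    {v : GroupLieAlgebra 𝓘(ℝ, E) G} {W : Matrix (Fin (p + q)) (Fin r) ℝ}
    (hv : ∀ y, A.infinitesimal v y = libraryField W Θ y) (n : ℕ) (z : Jet p q n) :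
    (∀ᶠ ε : ℝ in 𝓝 0, ∃! z', A.IsProlongation n (lieExp (ε • v)) z z') ∧
    ∃ z' : Jet p q n, HasDerivAt (fun ε : ℝ => A.prolong n (lieExp (ε • v)) z) z' 0 ∧
      z'.1 = (libraryField W Θ z.base).1 ∧
      ∀ (k : ℕ) (hkn : k ≤ n) (J : Fin k → Fin p) (α : Fin q),
        z'.2 ⟨Finset.univ.val.map J, by simpa using hkn⟩ α = prolongationCoeff W Θ J α z := by
  obtain ⟨f, hf, hz⟩ := exists_jet_eq z
  obtain ⟨c, c', hc0, hc, hexp⟩ := exists_chart_curve v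
  set a₀ := extChartAt 𝓘(ℝ, E) (1 : G) 1 with ha₀
  have hct : Filter.Tendsto c (𝓝 0) (𝓝 a₀) := by
    have := hc.continuousAt
    rwa [ContinuousAt, hc0] at this
  have hev : ∀ᶠ ε : ℝ in 𝓝 0,
      A.IsProlongation n (lieExp (ε • v)) z (A.localProlong n f z.1 (c ε)) := by
    filter_upwards [hexp, hct.eventually (eventually_isProlongation hf n z.1)] with ε h1 h2
    rwa [h1, hz] at h2
  obtain ⟨L, hL, hLc⟩ := hasFDerivAt_localProlong (A := A) hf n z.1
  have hfield : ∀ x, fderiv ℝ A.localAct (a₀, (x, f x)) (c', 0) = libraryField W Θ (x, f x) :=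
    fun x => by rw [← hv, A.infinitesimal_eq hc0 hc hexp]
  refine ⟨?_, L c', ?_, ?_, ?_⟩
  · filter_upwards [hev] with ε hε
    exact ⟨_, hε, fun z' hz' => isProlongation_unique hz' hε⟩
  · have h1 : HasDerivAt (fun ε => A.localProlong n f z.1 (c ε)) (L c') 0 := by
      rw [← ha₀, ← hc0] at hL
      exact hL.comp_hasDerivAt (0 : ℝ) hc
    refine h1.congr_of_eventuallyEq ?_
    filter_upwards [hev] with ε hε
    exact prolong_eq hε
  · have hb : z.base = (z.1, f z.1) := by
      conv_lhs => rw [← hz]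
      exact jet_base f z.1
    rw [hLc, hb, ← hfield]
    exact fderiv_graphFst hf (A.contDiffAt_localAct_one _) c'
  · intro k hkn J α
    have hs := fun x => A.contDiffAt_localAct_one (x, f x)
    have hlib : ContDiff ℝ ∞ fun x => libraryField W Θ (x, f x) := by
      have hc : ∀ w : Fin r → ℝ, ContDiff ℝ ∞ fun y => Θ (y, f y) ⬝ᵥ w := fun w =>
        ContDiff.sum fun a _ =>
          ((contDiff_pi.1 hΘ a).comp (contDiff_id.prodMk hf)).mul contDiff_const
      exact (contDiff_pi.2 fun i => hc _).prodMk (contDiff_pi.2 fun α => hc _)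
    -- The first variation, with `ξ` and `η` the components of `W Θ` along the graph of `f`.
    have key := fderiv_transDeriv_fst (φ := A.graphFst f) (ψ := A.graphSnd f α) (a₀ := a₀)
      (contDiff_apply_component hf α)
      (fun x => contDiffAt_graphFst hf (hs x)) (fun x => contDiffAt_graphSnd hf (hs x) α)
      graphFst_one (graphSnd_one α) c' (ξ := fun i x => (libraryField W Θ (x, f x)).1 i)
      (fun i => contDiff_pi.1 hlib.fst i) (η := fun x => (libraryField W Θ (x, f x)).2 α)
      (contDiff_pi.1 hlib.snd α)
      (fun x i => by rw [← hfield, fderiv_graphFst (w := (_, x)) hf (hs x)])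
      (fun x => by rw [← hfield, fderiv_graphSnd (w := (_, x)) hf (hs x)])
      ((Finset.univ.val.map J).sort (· ≤ ·)) z.1
    rw [hLc]
    refine key.trans ?_
    conv_rhs => rw [← hz]
    rw [prolongationCoeff_jet hΘ W hf hkn, Multiset.sort_eq]

end Prolong

end LieGroupAction

/-! ### Linearity of the prolonged vector field in the coefficient matrix -/

section Linear

variable {p q r n : ℕ}

theorem base_proj (m : ℕ) (z : Jet p q n) : (z.proj m).base = z.base :=
  Prod.ext rfl (funext fun α => by simp [Jet.base, Jet.proj, Jet.u])

/-- The empty set has no proper subset, so the general coefficient also covers the coordinates `u^α`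
of order zero. -/
theorem prolongationCoeff_zero (W : Matrix (Fin (p + q)) (Fin r) ℝ) (Θ : Total p q → Fin r → ℝ)
    (J : Fin 0 → Fin p) (α : Fin q) (z : Jet p q n) :
    prolongationCoeff W Θ J α z = (libraryField W Θ z.base).2 α := by
  have h1 : subtuple J Finset.univ = [] := List.eq_nil_of_length_eq_zero (by simp [subtuple])
  have h2 : totalDerivLibrary Θ [] z = Θ z.base := by
    funext a
    change Θ (z.proj 0).base a = _
    rw [base_proj]
  have h3 : (Finset.univ : Finset (Fin 0)).ssubsets = ∅ := by simp [Finset.ssubsets]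
  rw [prolongationCoeff, h1, h2, h3]
  simp [libraryField]

theorem prolongationCoeff_add {k : ℕ} (W W' : Matrix (Fin (p + q)) (Fin r) ℝ)
    (Θ : Total p q → Fin r → ℝ) (J : Fin k → Fin p) (α : Fin q) (z : Jet p q n) :
    prolongationCoeff (W + W') Θ J α z =
      prolongationCoeff W Θ J α z + prolongationCoeff W' Θ J α z := by
  have h : ∀ i, (W + W') i = W i + W' i := fun _ => rfl
  simp only [prolongationCoeff, h, dotProduct_add, mul_add, Finset.sum_add_distrib]
  ring

theorem prolongationCoeff_smul {k : ℕ} (c : ℝ) (W : Matrix (Fin (p + q)) (Fin r) ℝ)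
    (Θ : Total p q → Fin r → ℝ) (J : Fin k → Fin p) (α : Fin q) (z : Jet p q n) :
    prolongationCoeff (c • W) Θ J α z = c * prolongationCoeff W Θ J α z := by
  have h : ∀ i, (c • W) i = c • W i := fun _ => rfl
  simp only [prolongationCoeff, h, dotProduct_smul, smul_eq_mul, mul_left_comm _ c,
    ← Finset.mul_sum]
  ring

/-- The coordinates of the prolonged vector field, as a linear function of `W`. -/
def prolongedField (Θ : Total p q → Fin r → ℝ) (z : Jet p q n) :
    Matrix (Fin (p + q)) (Fin r) ℝ →ₗ[ℝ] JetCoord p q n → ℝ where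
  toFun W := Sum.elim (libraryField W Θ z.base).1
    fun c => prolongationCoeff W Θ (c.1.1.sort (· ≤ ·)).get c.2 z
  map_add' W W' := by
    funext c
    rcases c with i | c
    · exact dotProduct_add (Θ z.base) (W _) (W' _)
    · exact prolongationCoeff_add W W' Θ _ c.2 z
  map_smul' a W := by
    funext c
    rcases c with i | c
    · exact dotProduct_smul a (Θ z.base) (W _)
    · exact prolongationCoeff_smul a W Θ _ c.2 z

/-- The matrix of the prolonged vector field, as a linear function of `vec(W)`. -/
def prolongedLibrary (Θ : Total p q → Fin r → ℝ) (z : Jet p q n) :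
    Matrix (JetCoord p q n) (Fin (p + q) × Fin r) ℝ :=
  Matrix.of fun c s => prolongedField Θ z (Matrix.single s.1 s.2 1) c

/-- Expand `W` in matrix units. `Matrix.vec` stacks columns, so the transpose is what lists the rows
of `W`. -/
theorem prolongedLibrary_mulVec (Θ : Total p q → Fin r → ℝ) (z : Jet p q n)
    (W : Matrix (Fin (p + q)) (Fin r) ℝ) :
    prolongedLibrary Θ z *ᵥ Wᵀ.vec = prolongedField Θ z W := by
  funext c
  conv_rhs => rw [Matrix.matrix_eq_sum_single W]
  have h : ∀ i j, Matrix.single i j (W i j) = W i j • Matrix.single i j (1 : ℝ) := fun i j => by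
    rw [Matrix.smul_single, smul_eq_mul, mul_one]
  simp only [map_sum, h, map_smul, Finset.sum_apply, Pi.smul_apply, smul_eq_mul]
  rw [Matrix.mulVec, dotProduct, Fintype.sum_prod_type]
  refine Finset.sum_congr rfl fun i _ => Finset.sum_congr rfl fun j _ => ?_
  simp [prolongedLibrary, Matrix.vec, mul_comm]

theorem eq_map_univ_get (J : MultiIndex p n) :
    Finset.univ.val.map (J.1.sort (· ≤ ·)).get = J.1 := by
  rw [Fin.univ_val_map, List.ofFn_get, Multiset.sort_eq]

end Linear

end Prolongation

end

/-! ### Assembly of the theorem -/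

open Prolongation in
theorem theorem1 (p q r n : ℕ) (Θ : Total p q → Fin r → ℝ) (hΘ : ContDiff ℝ ∞ Θ) :
    ∃ Θn : Jet p q n → Matrix (JetCoord p q n) (Fin (p + q) × Fin r) ℝ,
      ∀ {E : Type*} [NormedAddCommGroup E] [NormedSpace ℝ E] [FiniteDimensional ℝ E]
        {G : Type*} [TopologicalSpace G] [ChartedSpace E G] [Group G] [LieGroup 𝓘(ℝ, E) ∞ G]
        [T2Space G] (A : LieGroupAction E G (Total p q)) (v : GroupLieAlgebra 𝓘(ℝ, E) G)
        (W : Matrix (Fin (p + q)) (Fin r) ℝ),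
        (∀ y, A.infinitesimal v y = libraryField W Θ y) →
        ∀ z : Jet p q n,
          -- `pr^(n)[exp(εv)]` is well defined at `z` for small `ε`, and differentiable at `ε = 0`
          (∀ᶠ ε : ℝ in 𝓝 0, ∃! z', A.IsProlongation n (lieExp (ε • v)) z z') ∧
          DifferentiableAt ℝ (fun ε : ℝ => A.prolong n (lieExp (ε • v)) z) 0 ∧
          -- the components of `pr^(n) v` along `∂/∂x^i` and `∂/∂u^α` are those of `v`
          (A.prolongInfinitesimal n v z).base = libraryField W Θ z.base ∧
          -- the components of `pr^(n) v` along `∂/∂u_J^α`, where `J = (j₁, …, j_k)`, `1 ≤ k ≤ n`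
          (∀ (k : ℕ) (_ : 1 ≤ k) (hkn : k ≤ n) (J : Fin k → Fin p) (α : Fin q),
            (A.prolongInfinitesimal n v z).2
                ⟨Finset.univ.val.map J, by simpa using hkn⟩ α =
              prolongationCoeff W Θ J α z) ∧
          -- linearity in `vec(W)`
          (A.prolongInfinitesimal n v z).coords = Θn z *ᵥ Wᵀ.vec := by
  -- The matrix is fixed before the group, the action, `v` and `W` are introduced.
  refine ⟨prolongedLibrary Θ, fun A v W hv z => ?_⟩
  obtain ⟨huniq, z', hz', hfst, hcoeff⟩ := A.hasDerivAt_prolong hΘ hv n z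
  have hpr : A.prolongInfinitesimal n v z = z' := hz'.deriv
  refine ⟨huniq, hz'.differentiableAt, ?_, fun k _ hkn J α => ?_, ?_⟩
  · rw [hpr]
    refine Prod.ext hfst (funext fun α => ?_)
    rw [← prolongationCoeff_zero W Θ Fin.elim0, ← hcoeff 0 (Nat.zero_le n)]
    rfl
  · rw [hpr, hcoeff k hkn]
  · rw [hpr, prolongedLibrary_mulVec]
    funext c
    rcases c with i | ⟨J, α⟩
    · exact congrFun hfst i
    · have hl : (J.1.sort (· ≤ ·)).length ≤ n := by simpa using J.2
      -- An unordered multi-index is read as the tuple of its sorted entries, the ordering used in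
      -- `prolongedField`.
      refine Eq.trans ?_ (hcoeff _ hl (J.1.sort (· ≤ ·)).get α)
      exact congrArg (fun I => z'.2 I α) (Subtype.ext (eq_map_univ_get J).symm)
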